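/- Let $n\ge 0$ and $s\ge 1$ be integers and let $(M^{2n+s},f,\xi_\alpha,\eta_\alpha,g)$, $\alpha=1,\dots,s$, be a nonempty compact metric $f$-$K$-contact manifold. That is, $M$ is a smooth closed manifold of dimension $2n+s$ with a smooth $(1,1)$-tensor $f$, smooth vector fields $\xi_1,\dots,\xi_s$, smooth one-forms $\eta_1,\dots,\eta_s$ and a Riemannian metric $g$ such that, for all $\alpha,\beta$ and all tangent vectors $X,Y$, $$\eta_\alpha(\xi_\beta)=\delta_{\alpha\beta},\quad f(\xi_\alpha)=0,\quad \eta_\alpha\circ f=0,\quad f^2=-\mathrm{id}+\sum_{\alpha=1}^s\eta_\alpha\otimes\xi_\alpha,$$ $$g(fX,fY)=g(X,Y)-\sum_{\alpha=1}^s\eta_\alpha(X)\eta_\alpha(Y),\qquad d\eta_\alpha=\omega,\quad\text{where } \omega(X,Y):=g(X,fY),$$ and every $\xi_\alpha$ is a Killing vector field of $g$. Let $\mathcal F$ be the characteristic foliation of $M$, i.e. the foliation whose tangent spaces are spanned by $\xi_1,\dots,\xi_s$, let $\Xi(\mathcal F)$ be the space of smooth vector fields tangent to $\mathcal F$, and let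 $H^*(M,\mathcal F)$ be the basic cohomology of $\mathcal F$, i.e. the cohomology of the subcomplex $$\Omega^*(M,\mathcal F)=\{\sigma\in\Omega^*(M)\mid i_X\sigma=\mathcal L_X\sigma=0 \text{ for all } X\in\Xi(\mathcal F)\}$$ of the de Rham complex $(\Omega^*(M),d)$. Then for every $k=0,\dots,n$ the $k$-fold wedge power $\omega^k$ (with $\omega^0=1$) is a closed form in $\Omega^{2k}(M,\mathcal F)$, and its class in $H^{2k}(M,\mathcal F)$ is nonzero. -/

import Mathlib

open scoped Manifold ContDiff Bundle

noncomputable section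

namespace FKContact

/-! ### Wedge product of alternating forms on a vector space -/

section Wedge

variable {V : Type*} [AddCommGroup V] [Module ℝ V] [TopologicalSpace V]

/-- The tensor product `(a ⊗ b)(v₁, …, v_{p+q}) = a(v₁, …, v_p) b(v_{p+1}, …, v_{p+q})`. -/
def tensor {p q : ℕ} (a : V [⋀^Fin p]→L[ℝ] ℝ) (b : V [⋀^Fin q]→L[ℝ] ℝ) :
    ContinuousMultilinearMap ℝ (fun _ : Fin (p + q) => V) ℝ where
  toMultilinearMap :=
    ((LinearMap.mul' ℝ ℝ).compMultilinearMap
      (MultilinearMap.domCoprod a.toMultilinearMap b.toMultilinearMap)).domDomCongr finSumFinEquiv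
  cont := by
    change Continuous fun v : Fin (p + q) → V =>
      a (fun i => v (Fin.castAdd q i)) * b (fun j => v (Fin.natAdd p j))
    exact (a.cont.comp (continuous_pi fun i => continuous_apply _)).mul
      (b.cont.comp (continuous_pi fun i => continuous_apply _))

theorem tensor_apply {p q : ℕ} (a : V [⋀^Fin p]→L[ℝ] ℝ) (b : V [⋀^Fin q]→L[ℝ] ℝ)
    (v : Fin (p + q) → V) :
    tensor a b v = a (fun i => v (Fin.castAdd q i)) * b (fun j => v (Fin.natAdd p j)) :=
  rfl

/-- The wedge product
`(a ∧ b)(v) = 1/(p! q!) ∑_σ sgn(σ) a(v_{σ(1)}, …, v_{σ(p)}) b(v_{σ(p+1)}, …, v_{σ(p+q)})`. -/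
def wedge {p q : ℕ} (a : V [⋀^Fin p]→L[ℝ] ℝ) (b : V [⋀^Fin q]→L[ℝ] ℝ) :
    V [⋀^Fin (p + q)]→L[ℝ] ℝ :=
  ((p.factorial * q.factorial : ℝ)⁻¹) • ContinuousMultilinearMap.alternatization (tensor a b)

/-- The `k`-th wedge power `a^k = a ∧ ⋯ ∧ a`, with `a^0 = 1`. -/
def wedgePow {p : ℕ} (a : V [⋀^Fin p]→L[ℝ] ℝ) : (k : ℕ) → V [⋀^Fin (p * k)]→L[ℝ] ℝ
  | 0 => ContinuousAlternatingMap.constOfIsEmpty ℝ V (Fin 0) 1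
  | k + 1 => wedge (wedgePow a k) a

end Wedge

/-! ### Differential forms on a manifold without boundary modelled on `E` -/

section Forms

variable {E : Type*} [NormedAddCommGroup E] [NormedSpace ℝ E]
  {M : Type*} [TopologicalSpace M] [ChartedSpace E M]

variable (E M) in
/-- (Not necessarily smooth) differential forms of degree `k` on `M`. -/
def FormField (k : ℕ) : Type _ :=
  ∀ x : M, TangentSpace 𝓘(ℝ, E) x [⋀^Fin k]→L[ℝ] ℝ

instance (k : ℕ) : AddCommGroup (FormField E M k) :=
  inferInstanceAs (AddCommGroup (∀ x : M, TangentSpace 𝓘(ℝ, E) x [⋀^Fin k]→L[ℝ] ℝ))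

instance (k : ℕ) : Module ℝ (FormField E M k) :=
  inferInstanceAs (Module ℝ (∀ x : M, TangentSpace 𝓘(ℝ, E) x [⋀^Fin k]→L[ℝ] ℝ))

@[simp] theorem FormField.add_apply {k : ℕ} (σ τ : FormField E M k) (x : M) :
    (σ + τ) x = σ x + τ x := rfl

@[simp] theorem FormField.smul_apply {k : ℕ} (c : ℝ) (σ : FormField E M k) (x : M) :
    (c • σ) x = c • σ x := rfl

@[simp] theorem FormField.zero_apply {k : ℕ} (x : M) : (0 : FormField E M k) x = 0 := rfl

variable (E M) in
/-- (Not necessarily smooth) vector fields on `M`. -/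
abbrev VField : Type _ := ∀ x : M, TangentSpace 𝓘(ℝ, E) x

/-- Smoothness of a vector field, as a section of the tangent bundle. -/
def IsSmoothVField [IsManifold 𝓘(ℝ, E) ∞ M] (X : VField E M) : Prop :=
  ContMDiff 𝓘(ℝ, E) (𝓘(ℝ, E).prod 𝓘(ℝ, E)) ∞ fun x => Bundle.TotalSpace.mk' E x (X x)

/-- The expression of a form in the chart `φ` at `x₀`, i.e. the pullback `(φ⁻¹)^* σ`, a form on
the open set `φ.target` of `E`. -/
def chartForm {k : ℕ} (σ : FormField E M k) (x₀ : M) : E → E [⋀^Fin k]→L[ℝ] ℝ :=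
  fun y => (σ ((extChartAt 𝓘(ℝ, E) x₀).symm y)).compContinuousLinearMap
    (mfderiv 𝓘(ℝ, E) 𝓘(ℝ, E) (extChartAt 𝓘(ℝ, E) x₀).symm y)

/-- The expression of a vector field in the chart at `x₀`. -/
def chartVField (X : VField E M) (x₀ : M) : E → E :=
  VectorField.mpullback 𝓘(ℝ, E) 𝓘(ℝ, E) (extChartAt 𝓘(ℝ, E) x₀).symm X

/-- A form is smooth if all its expressions in charts are. -/
def IsSmoothForm {k : ℕ} (σ : FormField E M k) : Prop :=
  ∀ x₀ : M, ContDiffOn ℝ ∞ (chartForm σ x₀) (extChartAt 𝓘(ℝ, E) x₀).target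

/-- The exterior derivative, computed at `x` in the chart at `x`:
`dσ(v₀, …, v_k) = ∑ᵢ (-1)^i ∂_{vᵢ} σ(v₀, …, v̂ᵢ, …, v_k)`. -/
def extDer {k : ℕ} (σ : FormField E M k) : FormField E M (k + 1) :=
  fun x => (extDeriv (chartForm σ x) (extChartAt 𝓘(ℝ, E) x x)).compContinuousLinearMap
    (mfderiv 𝓘(ℝ, E) 𝓘(ℝ, E) (extChartAt 𝓘(ℝ, E) x) x)

/-- The Lie derivative of a form on (an open subset of) `E`:
`(L_X σ)_y(v₁, …, v_k) = (∂_X σ)_y(v₁, …, v_k) + ∑ᵢ σ_y(v₁, …, ∂_{vᵢ} X, …, v_k)`. -/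
def lieDerivE {k : ℕ} (X : E → E) (σ : E → E [⋀^Fin k]→L[ℝ] ℝ) (y : E) (v : Fin k → E) : ℝ :=
  fderiv ℝ σ y (X y) v + ∑ i, σ y (Function.update v i (fderiv ℝ X y (v i)))

/-- The Lie derivative `(L_X σ)_x(v₁, …, v_k)` on `M`, computed at `x` in the chart at `x`. -/
def lieDer {k : ℕ} (X : VField E M) (σ : FormField E M k) (x : M)
    (v : Fin k → TangentSpace 𝓘(ℝ, E) x) : ℝ :=
  lieDerivE (chartVField X x) (chartForm σ x) (extChartAt 𝓘(ℝ, E) x x)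
    fun i => mfderiv 𝓘(ℝ, E) 𝓘(ℝ, E) (extChartAt 𝓘(ℝ, E) x) x (v i)

/-- The condition `i_X σ = 0`; it is void for functions. -/
def ContractsToZero (X : VField E M) : {k : ℕ} → FormField E M k → Prop
  | 0, _ => True
  | k + 1, σ => ∀ (x : M) (v : Fin k → TangentSpace 𝓘(ℝ, E) x), σ x (Matrix.vecCons (X x) v) = 0

theorem chartForm_add {k : ℕ} (σ τ : FormField E M k) (x₀ : M) :
    chartForm (σ + τ) x₀ = chartForm σ x₀ + chartForm τ x₀ := rfl

theorem chartForm_smul {k : ℕ} (c : ℝ) (σ : FormField E M k) (x₀ : M) :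
    chartForm (c • σ) x₀ = c • chartForm σ x₀ := rfl

theorem chartForm_zero {k : ℕ} (x₀ : M) : chartForm (0 : FormField E M k) x₀ = 0 := rfl

theorem IsSmoothForm.differentiableAt {k : ℕ} {σ : FormField E M k} (h : IsSmoothForm σ) (x : M) :
    DifferentiableAt ℝ (chartForm σ x) (extChartAt 𝓘(ℝ, E) x x) :=
  ((h x).contDiffAt (extChartAt_target_mem_nhds x)).differentiableAt (by simp)

theorem extDer_add {k : ℕ} {σ τ : FormField E M k} (hσ : IsSmoothForm σ) (hτ : IsSmoothForm τ) :
    extDer (σ + τ) = extDer σ + extDer τ := by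
  funext x
  simp only [extDer, chartForm_add]
  rw [extDeriv_add (hσ.differentiableAt x) (hτ.differentiableAt x)]
  rfl

theorem extDer_smul {k : ℕ} (c : ℝ) (σ : FormField E M k) :
    extDer (c • σ) = c • extDer σ := by
  funext x
  simp only [extDer, chartForm_smul]
  rw [extDeriv_smul]
  rfl

theorem extDer_zero {k : ℕ} : extDer (0 : FormField E M k) = 0 := by
  simpa using extDer_smul (0 : ℝ) (0 : FormField E M k)

theorem lieDer_add {k : ℕ} (X : VField E M) {σ τ : FormField E M k} (hσ : IsSmoothForm σ)
    (hτ : IsSmoothForm τ) (x : M) (v : Fin k → TangentSpace 𝓘(ℝ, E) x) :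
    lieDer X (σ + τ) x v = lieDer X σ x v + lieDer X τ x v := by
  simp only [lieDer, lieDerivE, chartForm_add]
  rw [fderiv_add (hσ.differentiableAt x) (hτ.differentiableAt x)]
  simp only [Pi.add_apply, ContinuousAlternatingMap.add_apply, Finset.sum_add_distrib]
  exact add_add_add_comm _ _ _ _

theorem lieDer_smul {k : ℕ} (X : VField E M) (c : ℝ) {σ : FormField E M k} (hσ : IsSmoothForm σ)
    (x : M) (v : Fin k → TangentSpace 𝓘(ℝ, E) x) :
    lieDer X (c • σ) x v = c * lieDer X σ x v := by
  simp only [lieDer, lieDerivE, chartForm_smul]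
  rw [fderiv_const_smul (hσ.differentiableAt x)]
  simp only [Pi.smul_apply, ContinuousAlternatingMap.smul_apply, smul_eq_mul, mul_add,
    Finset.mul_sum]
  rfl

theorem isSmoothForm_zero {k : ℕ} : IsSmoothForm (0 : FormField E M k) := fun x₀ => by
  rw [chartForm_zero]
  exact contDiffOn_const

theorem lieDer_zero {k : ℕ} (X : VField E M) (x : M) (v : Fin k → TangentSpace 𝓘(ℝ, E) x) :
    lieDer X (0 : FormField E M k) x v = 0 := by
  simpa using lieDer_smul X 0 isSmoothForm_zero x v (σ := (0 : FormField E M k))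

/-! ### Basic forms and basic cohomology

A foliation enters only through its tangent distribution `D`. -/

variable [IsManifold 𝓘(ℝ, E) ∞ M]

/-- `Ξ(𝓕)`: smooth vector fields tangent to the foliation. -/
def tangentVFields (D : ∀ x : M, Submodule ℝ (TangentSpace 𝓘(ℝ, E) x)) : Set (VField E M) :=
  {X | IsSmoothVField X ∧ ∀ x, X x ∈ D x}

/-- `Ω^k(M, 𝓕)`: smooth forms `σ` with `i_X σ = L_X σ = 0` for all `X ∈ Ξ(𝓕)`. -/
def basicForms (D : ∀ x : M, Submodule ℝ (TangentSpace 𝓘(ℝ, E) x)) (k : ℕ) :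
    Submodule ℝ (FormField E M k) where
  carrier := {σ | IsSmoothForm σ ∧ ∀ X ∈ tangentVFields D,
    ContractsToZero X σ ∧ ∀ x v, lieDer X σ x v = 0}
  zero_mem' := by
    refine ⟨isSmoothForm_zero, fun X _ => ⟨?_, fun x v => lieDer_zero X x v⟩⟩
    cases k with
    | zero => trivial
    | succ k => intro x v; rfl
  add_mem' := by
    rintro σ τ ⟨hσ, hσ'⟩ ⟨hτ, hτ'⟩
    refine ⟨fun x₀ => (hσ x₀).add (hτ x₀), fun X hX => ⟨?_, fun x v => ?_⟩⟩
    · cases k with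
      | zero => trivial
      | succ k =>
        intro x v
        have h1 := (hσ' X hX).1 x v
        have h2 := (hτ' X hX).1 x v
        simp [h1, h2]
    · rw [lieDer_add X hσ hτ, (hσ' X hX).2, (hτ' X hX).2, add_zero]
  smul_mem' := by
    rintro c σ ⟨hσ, hσ'⟩
    refine ⟨fun x₀ => (hσ x₀).const_smul c, fun X hX => ⟨?_, fun x v => ?_⟩⟩
    · cases k with
      | zero => trivial
      | succ k =>
        intro x v
        have h1 := (hσ' X hX).1 x v
        simp [h1]
    · rw [lieDer_smul X c hσ, (hσ' X hX).2, mul_zero]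

/-- Closed basic forms. -/
def closedBasicForms (D : ∀ x : M, Submodule ℝ (TangentSpace 𝓘(ℝ, E) x)) (k : ℕ) :
    Submodule ℝ (FormField E M k) where
  carrier := {σ | σ ∈ basicForms D k ∧ extDer σ = 0}
  zero_mem' := ⟨zero_mem _, extDer_zero⟩
  add_mem' := by
    rintro σ τ ⟨hσ, hσ'⟩ ⟨hτ, hτ'⟩
    exact ⟨add_mem hσ hτ, by rw [extDer_add hσ.1 hτ.1, hσ', hτ', add_zero]⟩
  smul_mem' := by
    rintro c σ ⟨hσ, hσ'⟩
    exact ⟨Submodule.smul_mem _ c hσ, by rw [extDer_smul, hσ', smul_zero]⟩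

/-- Exterior derivatives of basic forms of degree `k - 1` (only `0` if `k = 0`). -/
def exactBasicForms (D : ∀ x : M, Submodule ℝ (TangentSpace 𝓘(ℝ, E) x)) :
    (k : ℕ) → Submodule ℝ (FormField E M k)
  | 0 => ⊥
  | k + 1 =>
    { carrier := {σ | ∃ τ ∈ basicForms D k, extDer τ = σ}
      zero_mem' := ⟨0, zero_mem _, extDer_zero⟩
      add_mem' := by
        rintro _ _ ⟨τ, hτ, rfl⟩ ⟨τ', hτ', rfl⟩
        exact ⟨τ + τ', add_mem hτ hτ', extDer_add hτ.1 hτ'.1⟩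
      smul_mem' := by
        rintro c _ ⟨τ, hτ, rfl⟩
        exact ⟨c • τ, Submodule.smul_mem _ c hτ, extDer_smul c τ⟩ }

/-- The basic cohomology `H^k(M, 𝓕)`: closed basic `k`-forms modulo exterior derivatives of basic
`(k-1)`-forms. -/
abbrev BasicCohomology (D : ∀ x : M, Submodule ℝ (TangentSpace 𝓘(ℝ, E) x)) (k : ℕ) : Type _ :=
  closedBasicForms D k ⧸ (exactBasicForms D k).submoduleOf (closedBasicForms D k)

/-- The class in `H^k(M, 𝓕)` of a closed basic form. -/
def basicClass (D : ∀ x : M, Submodule ℝ (TangentSpace 𝓘(ℝ, E) x)) {k : ℕ}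
    (σ : FormField E M k) (hσ : σ ∈ closedBasicForms D k) : BasicCohomology D k :=
  Submodule.Quotient.mk ⟨σ, hσ⟩

end Forms

/-! ### Metric `f`-manifolds -/

section Structures

variable {E : Type*} [NormedAddCommGroup E] [NormedSpace ℝ E]
  {M : Type*} [TopologicalSpace M] [ChartedSpace E M] [IsManifold 𝓘(ℝ, E) ∞ M]

variable (E M) in
/-- The structure tensors `(f, ξ_α, η_α, g)`, `α = 1, …, s`, of a metric `f`-manifold. The relations
imply `f³ + f = 0`, that the `ξ_α` span the kernel of `f`, and hence that `f` has constant rank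
`dim M - s`. -/
structure MetricFStructure (s : ℕ) where
  /-- the `(1,1)`-tensor -/
  f : ∀ x : M, TangentSpace 𝓘(ℝ, E) x →L[ℝ] TangentSpace 𝓘(ℝ, E) x
  /-- the characteristic vector fields -/
  ξ : Fin s → VField E M
  /-- the dual one-forms -/
  η : Fin s → FormField E M 1
  /-- the compatible Riemannian metric -/
  g : Bundle.ContMDiffRiemannianMetric 𝓘(ℝ, E) ∞ E (fun x : M => TangentSpace 𝓘(ℝ, E) x)
  smooth_f : ContMDiff 𝓘(ℝ, E) (𝓘(ℝ, E).prod 𝓘(ℝ, E →L[ℝ] E)) ∞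
    fun x => Bundle.TotalSpace.mk' (E →L[ℝ] E)
      (E := fun x : M => TangentSpace 𝓘(ℝ, E) x →L[ℝ] TangentSpace 𝓘(ℝ, E) x) x (f x)
  smooth_ξ : ∀ α, IsSmoothVField (ξ α)
  smooth_η : ∀ α, IsSmoothForm (η α)
  η_ξ : ∀ α β x, η α x ![ξ β x] = if α = β then 1 else 0
  f_ξ : ∀ α x, f x (ξ α x) = 0
  η_f : ∀ α x v, η α x ![f x v] = 0
  f_sq : ∀ x v, f x (f x v) = -v + ∑ α, η α x ![v] • ξ α x
  compat : ∀ x v w, g.inner x (f x v) (f x w) = g.inner x v w - ∑ α, η α x ![v] * η α x ![w]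

namespace MetricFStructure

variable {s : ℕ} (S : MetricFStructure E M s)

theorem inner_ξ (α : Fin s) (x : M) (v : TangentSpace 𝓘(ℝ, E) x) :
    S.g.inner x v (S.ξ α x) = S.η α x ![v] := by
  have h := S.compat x v (S.ξ α x)
  rw [S.f_ξ, map_zero] at h
  simp only [S.η_ξ, mul_ite, mul_one, mul_zero, Finset.sum_ite_eq', Finset.mem_univ, if_true] at h
  linarith

theorem inner_f_self (x : M) (v : TangentSpace 𝓘(ℝ, E) x) : S.g.inner x v (S.f x v) = 0 := by
  have h := S.compat x v (S.f x v)
  rw [S.f_sq] at h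
  simp only [map_add, map_neg, map_sum, map_smul, S.inner_ξ, S.η_f, smul_zero,
    Finset.sum_const_zero, mul_zero, sub_zero, add_zero] at h
  rw [S.g.symm x (S.f x v) v] at h
  linarith

/-- The fundamental 2-form `ω(X, Y) = g(X, f Y)`. -/
def fundForm : FormField E M 2 := fun x =>
  { toFun := fun v => S.g.inner x (v 0) (S.f x (v 1))
    map_update_add' := by
      intro inst v i a b
      rw [Subsingleton.elim inst (instDecidableEqFin 2)]
      fin_cases i <;> simp
    map_update_smul' := by
      intro inst v i c a
      rw [Subsingleton.elim inst (instDecidableEqFin 2)]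
      fin_cases i <;> simp
    map_eq_zero_of_eq' := by
      intro v i j h hij
      have h01 : v 0 = v 1 := by
        fin_cases i <;> fin_cases j <;> simp_all
      simp only [h01]
      exact S.inner_f_self x (v 1)
    cont := by
      have h1 : Continuous fun v : Fin 2 → E =>
          (show E →L[ℝ] E →L[ℝ] ℝ from S.g.inner x) (v 0)
            ((show E →L[ℝ] E from S.f x) (v 1)) := by
        fun_prop
      exact h1 }

/-- The tangent distribution of the characteristic foliation `𝓕`, spanned by the `ξ_α`. -/
def charDistribution (x : M) : Submodule ℝ (TangentSpace 𝓘(ℝ, E) x) :=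
  Submodule.span ℝ (Set.range fun α => S.ξ α x)

/-- Metric `f`-contact structures: `s > 0` and `dη_α = ω` for all `α`. -/
def IsContact : Prop := 0 < s ∧ ∀ α, extDer (S.η α) = S.fundForm

/-- `X` is a Killing field, `L_X g = 0`:
`X(g(Y, Z)) = g([X, Y], Z) + g(Y, [X, Z])` for all smooth vector fields `Y`, `Z`. -/
def IsKilling (X : VField E M) : Prop :=
  ∀ Y Z : VField E M, IsSmoothVField Y → IsSmoothVField Z → ∀ x,
    (mfderiv 𝓘(ℝ, E) 𝓘(ℝ, ℝ) (fun y => S.g.inner y (Y y) (Z y)) x (X x) : ℝ) =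
      S.g.inner x (VectorField.mlieBracket 𝓘(ℝ, E) X Y x) (Z x) +
        S.g.inner x (Y x) (VectorField.mlieBracket 𝓘(ℝ, E) X Z x)

/-- Metric `f`-`K`-contact structures. -/
def IsKContact : Prop := S.IsContact ∧ ∀ α, S.IsKilling (S.ξ α)

/-- The form `ω^k`, of degree `2k`. -/
def fundFormPow (k : ℕ) : FormField E M (2 * k) := fun x => wedgePow (S.fundForm x) k

end MetricFStructure

end Structures

end FKContact

end

/-! The contact condition `dη_α = ω` makes `ω` smooth and closed, and `ω` is annihilated by every
`ξ_α`. The same then holds for `ω^k`, and Cartan's formula shows that it is basic. The content of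
the theorem is that `ω^k` has no basic primitive.

For `k = 0` the only exact form is `0`, while `ω^0 = 1`. Let `k ≥ 1` and suppose `ω^k = dτ` with `τ`
basic. Since `ω` is closed, `τ ∧ ω^(n-k)` is a primitive of `ω^n`, still annihilated by every `ξ_α`
(`exists_primitive_of_le`). Wedge it successively with `η_1, …, η_s`. Each step contributes an
unwanted term `± T ∧ dη_j = ± T ∧ ω`, which is zero because its degree exceeds the codimension of
the span of the `ξ`'s not yet used, all of which annihilate it (`eq_zero_of_kills`). Hence `ω^n ∧
η_1 ∧ ⋯ ∧ η_s` is an exact top form (`exists_primitive_wedge_η`).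

This form vanishes nowhere. The radical of `ω` lies in the span of the `ξ_α`, so it has codimension
at least `2n` and `ω^n ≠ 0` (`wedgePow_ne_zero`, by splitting off hyperbolic planes); evaluating the
last slots on the `ξ_α` then detects the `η`'s (`wedge_append`).

An exact top form on a nonempty compact manifold must vanish somewhere (`exists_extDer_eq_zero`).
This is Stokes' theorem. No orientation is chosen: a nowhere vanishing `μ = dβ` supplies the density
`|μ|`, integrated chart by chart with a partition of unity.

The Leibniz rule rests on writing wedge products and exterior derivatives as signed sums over all
permutations, compared through `altSum_sum_sign`. -/

noncomputable section

namespace FKContact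

/-! ### Alternating sums over permutations -/

section AltSum

variable {V : Type*} {m : ℕ}

/-- The signed sum of `F (v ∘ σ)` over all permutations `σ`. -/
def altSum (F : (Fin m → V) → ℝ) (v : Fin m → V) : ℝ :=
  ∑ σ : Equiv.Perm (Fin m), ((Equiv.Perm.sign σ : ℤ) : ℝ) * F (v ∘ σ)

theorem sign_mul_self_cast (σ : Equiv.Perm (Fin m)) :
    ((Equiv.Perm.sign σ : ℤ) : ℝ) * ((Equiv.Perm.sign σ : ℤ) : ℝ) = 1 := by
  rcases Int.units_eq_one_or (Equiv.Perm.sign σ) with h | h <;> simp [h]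

/-- Reindexing by `σ ↦ σ * τ⁻¹` undoes `τ` and leaves its sign. -/
theorem altSum_comp_perm (F : (Fin m → V) → ℝ) (τ : Equiv.Perm (Fin m)) (v : Fin m → V) :
    altSum (fun w => F (w ∘ τ)) v = ((Equiv.Perm.sign τ : ℤ) : ℝ) * altSum F v := by
  unfold altSum
  rw [Finset.mul_sum, ← Equiv.sum_comp (Equiv.mulRight τ⁻¹)]
  refine Finset.sum_congr rfl fun σ _ => ?_
  have h : (v ∘ ⇑((Equiv.mulRight τ⁻¹) σ)) ∘ ⇑τ = v ∘ σ := by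
    funext i; simp
  simp only [h]
  simp [Equiv.Perm.sign_mul]
  ring

theorem altSum_const_mul (c : ℝ) (F : (Fin m → V) → ℝ) (v : Fin m → V) :
    altSum (fun w => c * F w) v = c * altSum F v := by
  unfold altSum
  rw [Finset.mul_sum]
  exact Finset.sum_congr rfl fun σ _ => by ring

theorem altSum_add (F G : (Fin m → V) → ℝ) (v : Fin m → V) :
    altSum (fun w => F w + G w) v = altSum F v + altSum G v := by
  simp only [altSum, mul_add, Finset.sum_add_distrib]

theorem altSum_sum {ι : Type*} (s : Finset ι) (F : ι → (Fin m → V) → ℝ) (v : Fin m → V) :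
    altSum (fun w => ∑ i ∈ s, F i w) v = ∑ i ∈ s, altSum (F i) v := by
  simp only [altSum, Finset.mul_sum]
  exact Finset.sum_comm

/-- Signed sums along a family of permutations do not change `altSum` except for the number of
terms. -/
theorem altSum_sum_sign {ι : Type*} [Fintype ι] (F : (Fin m → V) → ℝ)
    (τ : ι → Equiv.Perm (Fin m)) (v : Fin m → V) :
    altSum (fun w => ∑ i, ((Equiv.Perm.sign (τ i) : ℤ) : ℝ) * F (w ∘ τ i)) v =
      Fintype.card ι * altSum F v := by
  rw [altSum_sum]
  simp_rw [altSum_const_mul, altSum_comp_perm, ← mul_assoc, sign_mul_self_cast]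
  simp

theorem altSum_cast {m' : ℕ} (h : m = m') (F : (Fin m → V) → ℝ) (v : Fin m' → V) :
    altSum (fun w : Fin m' → V => F (w ∘ Fin.cast h)) v = altSum F (v ∘ Fin.cast h) := by
  subst h
  rfl

/-- The permutation of `Fin (p + q)` acting by `σ` on the first `p` and by `τ` on the last `q`
elements. -/
def blockPerm {p q : ℕ} (σ : Equiv.Perm (Fin p)) (τ : Equiv.Perm (Fin q)) :
    Equiv.Perm (Fin (p + q)) :=
  finSumFinEquiv.permCongr (Equiv.Perm.sumCongr σ τ)

theorem sign_blockPerm {p q : ℕ} (σ : Equiv.Perm (Fin p)) (τ : Equiv.Perm (Fin q)) :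
    Equiv.Perm.sign (blockPerm σ τ) = Equiv.Perm.sign σ * Equiv.Perm.sign τ := by
  rw [blockPerm, Equiv.Perm.sign_permCongr, Equiv.Perm.sign_sumCongr]

@[simp] theorem blockPerm_castAdd {p q : ℕ} (σ : Equiv.Perm (Fin p)) (τ : Equiv.Perm (Fin q))
    (i : Fin p) : blockPerm σ τ (Fin.castAdd q i) = Fin.castAdd q (σ i) := by
  simp [blockPerm, Equiv.permCongr_apply]

@[simp] theorem blockPerm_natAdd {p q : ℕ} (σ : Equiv.Perm (Fin p)) (τ : Equiv.Perm (Fin q))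
    (i : Fin q) : blockPerm σ τ (Fin.natAdd p i) = Fin.natAdd p (τ i) := by
  simp [blockPerm, Equiv.permCongr_apply]

end AltSum

/-! ### Algebra of the wedge product -/

section WedgeAlgebra

variable {V : Type*} [AddCommGroup V] [Module ℝ V] [TopologicalSpace V]
variable {p q r : ℕ}

theorem map_perm_cast (a : V [⋀^Fin p]→L[ℝ] ℝ) (v : Fin p → V) (σ : Equiv.Perm (Fin p)) :
    a (v ∘ σ) = ((Equiv.Perm.sign σ : ℤ) : ℝ) * a v := by
  have := a.toAlternatingMap.map_perm v σ
  rw [Units.smul_def, zsmul_eq_mul] at this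
  exact this

theorem altSum_coe (a : V [⋀^Fin p]→L[ℝ] ℝ) (v : Fin p → V) :
    altSum a v = p.factorial * a v := by
  simp_rw [altSum, map_perm_cast, ← mul_assoc, sign_mul_self_cast]
  simp [Fintype.card_perm]

theorem wedge_apply (a : V [⋀^Fin p]→L[ℝ] ℝ) (b : V [⋀^Fin q]→L[ℝ] ℝ) (v : Fin (p + q) → V) :
    wedge a b v = (p.factorial * q.factorial : ℝ)⁻¹ *
      altSum (fun w => a (w ∘ Fin.castAdd q) * b (w ∘ Fin.natAdd p)) v := by
  rw [wedge, ContinuousAlternatingMap.smul_apply, smul_eq_mul,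
    ContinuousMultilinearMap.alternatization_apply_apply]
  simp only [Units.smul_def, zsmul_eq_mul, tensor_apply]
  rfl

theorem wedge_add_left (a a' : V [⋀^Fin p]→L[ℝ] ℝ) (b : V [⋀^Fin q]→L[ℝ] ℝ) :
    wedge (a + a') b = wedge a b + wedge a' b := by
  ext v
  simp only [wedge_apply, ContinuousAlternatingMap.add_apply, add_mul, altSum_add, mul_add]

theorem wedge_add_right (a : V [⋀^Fin p]→L[ℝ] ℝ) (b b' : V [⋀^Fin q]→L[ℝ] ℝ) :
    wedge a (b + b') = wedge a b + wedge a b' := by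
  ext v
  simp only [wedge_apply, ContinuousAlternatingMap.add_apply, altSum_add, mul_add]

theorem wedge_smul_left (c : ℝ) (a : V [⋀^Fin p]→L[ℝ] ℝ) (b : V [⋀^Fin q]→L[ℝ] ℝ) :
    wedge (c • a) b = c • wedge a b := by
  ext v
  simp only [wedge_apply, ContinuousAlternatingMap.smul_apply, smul_eq_mul, mul_assoc,
    altSum_const_mul]
  ring

theorem wedge_smul_right (c : ℝ) (a : V [⋀^Fin p]→L[ℝ] ℝ) (b : V [⋀^Fin q]→L[ℝ] ℝ) :
    wedge a (c • b) = c • wedge a b := by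
  ext v
  simp only [wedge_apply, ContinuousAlternatingMap.smul_apply, smul_eq_mul, mul_left_comm _ c,
    altSum_const_mul]

theorem wedge_zero_left (b : V [⋀^Fin q]→L[ℝ] ℝ) :
    wedge (0 : V [⋀^Fin p]→L[ℝ] ℝ) b = 0 := by
  simpa using wedge_smul_left (0 : ℝ) (0 : V [⋀^Fin p]→L[ℝ] ℝ) b

theorem wedge_zero_right (a : V [⋀^Fin p]→L[ℝ] ℝ) :
    wedge a (0 : V [⋀^Fin q]→L[ℝ] ℝ) = 0 := by
  simpa using wedge_smul_right (0 : ℝ) a (0 : V [⋀^Fin q]→L[ℝ] ℝ)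

theorem wedge_compContinuousLinearMap {W : Type*} [AddCommGroup W] [Module ℝ W]
    [TopologicalSpace W] (a : V [⋀^Fin p]→L[ℝ] ℝ) (b : V [⋀^Fin q]→L[ℝ] ℝ) (L : W →L[ℝ] V) :
    (wedge a b).compContinuousLinearMap L =
      wedge (a.compContinuousLinearMap L) (b.compContinuousLinearMap L) := by
  ext v
  simp only [ContinuousAlternatingMap.compContinuousLinearMap_apply, wedge_apply]
  rfl

/-- The three-fold wedge product as a single alternating sum. -/
theorem wedge_wedge_apply (a : V [⋀^Fin p]→L[ℝ] ℝ) (b : V [⋀^Fin q]→L[ℝ] ℝ)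
    (c : V [⋀^Fin r]→L[ℝ] ℝ) (v : Fin (p + q + r) → V) :
    wedge (wedge a b) c v = (p.factorial * q.factorial * r.factorial : ℝ)⁻¹ *
      altSum (fun w => a (w ∘ Fin.castAdd r ∘ Fin.castAdd q) *
        b (w ∘ Fin.castAdd r ∘ Fin.natAdd p) * c (w ∘ Fin.natAdd (p + q))) v := by
  -- The inner sum runs over permutations of the first `p + q` slots. Extended by the identity, they
  -- are absorbed into the outer sum at the cost of a factor `(p + q)!`, which cancels the
  -- normalisation of the outer wedge.
  have key := altSum_sum_sign (fun w : Fin (p + q + r) → V =>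
    a (w ∘ Fin.castAdd r ∘ Fin.castAdd q) *
        b (w ∘ Fin.castAdd r ∘ Fin.natAdd p) * c (w ∘ Fin.natAdd (p + q)))
    (fun σ : Equiv.Perm (Fin (p + q)) => blockPerm σ (1 : Equiv.Perm (Fin r))) v
  rw [wedge_apply]
  simp_rw [wedge_apply a b]
  simp_rw [mul_assoc (_⁻¹ : ℝ), altSum_const_mul]
  have h : (fun w : Fin (p + q + r) → V =>
      altSum (fun w => a (w ∘ Fin.castAdd q) * b (w ∘ Fin.natAdd p)) (w ∘ Fin.castAdd r) *
        c (w ∘ Fin.natAdd (p + q))) =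
      fun w => ∑ σ : Equiv.Perm (Fin (p + q)),
        ((Equiv.Perm.sign (blockPerm σ (1 : Equiv.Perm (Fin r))) : ℤ) : ℝ) *
        (a ((w ∘ blockPerm σ (1 : Equiv.Perm (Fin r))) ∘ Fin.castAdd r ∘ Fin.castAdd q) *
        b ((w ∘ blockPerm σ (1 : Equiv.Perm (Fin r))) ∘ Fin.castAdd r ∘ Fin.natAdd p) *
        c ((w ∘ blockPerm σ (1 : Equiv.Perm (Fin r))) ∘ Fin.natAdd (p + q))) := by
    funext w
    rw [altSum, Finset.sum_mul]
    refine Finset.sum_congr rfl fun σ _ => ?_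
    rw [sign_blockPerm, Equiv.Perm.sign_one, mul_one, mul_assoc]
    have h1 : (w ∘ blockPerm σ (1 : Equiv.Perm (Fin r))) ∘ Fin.castAdd r ∘ Fin.castAdd q =
        ((w ∘ Fin.castAdd r) ∘ σ) ∘ Fin.castAdd q := by funext i; simp
    have h2 : (w ∘ blockPerm σ (1 : Equiv.Perm (Fin r))) ∘ Fin.castAdd r ∘ Fin.natAdd p =
        ((w ∘ Fin.castAdd r) ∘ σ) ∘ Fin.natAdd p := by funext i; simp
    have h3 : (w ∘ blockPerm σ (1 : Equiv.Perm (Fin r))) ∘ Fin.natAdd (p + q) =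
        w ∘ Fin.natAdd (p + q) := by funext i; simp
    rw [h1, h2, h3]
  rw [h, key, Fintype.card_perm, Fintype.card_fin]
  have := Nat.cast_ne_zero (R := ℝ).2 (p + q).factorial_ne_zero
  have := Nat.cast_ne_zero (R := ℝ).2 p.factorial_ne_zero
  have := Nat.cast_ne_zero (R := ℝ).2 q.factorial_ne_zero
  have := Nat.cast_ne_zero (R := ℝ).2 r.factorial_ne_zero
  field_simp

/-- `Kills a x` says that `a` vanishes as soon as one of its arguments is `x`. -/
def Kills (a : V [⋀^Fin p]→L[ℝ] ℝ) (x : V) : Prop :=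
  ∀ (v : Fin p → V) (i : Fin p), v i = x → a v = 0

/-- A swap of slots `0` and `i` changes only the sign, so contraction in the first slot controls all
slots. -/
theorem kills_of_vecCons {a : V [⋀^Fin (p + 1)]→L[ℝ] ℝ} {x : V}
    (h : ∀ v : Fin p → V, a (Matrix.vecCons x v) = 0) : Kills a x := by
  intro v i hi
  have h1 : v ∘ Equiv.swap 0 i = Matrix.vecCons x (Fin.tail (v ∘ Equiv.swap 0 i)) := by
    funext j
    refine Fin.cases ?_ (fun j => ?_) j
    · simp [hi]
    · simp [Fin.tail]
  have h2 := map_perm_cast a v (Equiv.swap 0 i)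
  rw [h1, h] at h2
  rcases Int.units_eq_one_or (Equiv.Perm.sign (Equiv.swap 0 i)) with h3 | h3 <;>
    simpa [h3] using h2.symm

/-- In every term of the alternating sum, `x` lands in a slot of `a` or in a slot of `b`. -/
theorem Kills.wedge {a : V [⋀^Fin p]→L[ℝ] ℝ} {b : V [⋀^Fin q]→L[ℝ] ℝ} {x : V}
    (ha : Kills a x) (hb : Kills b x) : Kills (wedge a b) x := by
  intro v i hi
  rw [wedge_apply, altSum, Finset.sum_eq_zero, mul_zero]
  intro σ _
  obtain ⟨j, hj⟩ := σ.surjective i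
  induction j using Fin.addCases with
  | left j => rw [ha _ j (by simp [hj, hi]), zero_mul, mul_zero]
  | right j => rw [hb _ j (by simp [hj, hi]), mul_zero, mul_zero]

theorem Kills.wedgePow {a : V [⋀^Fin p]→L[ℝ] ℝ} {x : V} (ha : Kills a x) (k : ℕ) :
    Kills (wedgePow a k) x := by
  induction k with
  | zero => intro v i; exact i.elim0
  | succ k ih => exact ih.wedge ha

theorem Kills.of_mem_span {a : V [⋀^Fin p]→L[ℝ] ℝ} {s : Set V} (ha : ∀ x ∈ s, Kills a x) {x : V}
    (hx : x ∈ Submodule.span ℝ s) : Kills a x := by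
  intro v i hi
  have : v = Function.update v i x := by rw [← hi, Function.update_eq_self]
  rw [this]
  clear hi this
  induction hx using Submodule.span_induction with
  | mem x hx => exact ha x hx _ i (by simp)
  | zero => exact a.map_coord_zero i (by simp)
  | add x y _ _ hx hy => rw [a.map_update_add, hx, hy, add_zero]
  | smul c x _ hx => rw [a.map_update_smul, hx, smul_zero]

/-- Evaluation of `a ∧ b` on two blocks of vectors, the second of which is killed by `a`. -/
theorem wedge_append (a : V [⋀^Fin p]→L[ℝ] ℝ) (b : V [⋀^Fin q]→L[ℝ] ℝ) (v : Fin p → V)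
    (w : Fin q → V) (h : ∀ j, Kills a (w j)) : wedge a b (Fin.append v w) = a v * b w := by
  classical
  rw [wedge_apply, altSum]
  -- Only block permutations contribute: any other one moves some `w j` into a slot of `a`, which
  -- kills it.
  have hsub : ∑ x : Equiv.Perm (Fin p) × Equiv.Perm (Fin q),
      ((Equiv.Perm.sign (blockPerm x.1 x.2) : ℤ) : ℝ) *
        (a ((Fin.append v w ∘ blockPerm x.1 x.2) ∘ Fin.castAdd q) *
        b ((Fin.append v w ∘ blockPerm x.1 x.2) ∘ Fin.natAdd p)) =
      ∑ σ : Equiv.Perm (Fin (p + q)), ((Equiv.Perm.sign σ : ℤ) : ℝ) *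
        (a ((Fin.append v w ∘ σ) ∘ Fin.castAdd q) * b ((Fin.append v w ∘ σ) ∘ Fin.natAdd p)) := by
    refine Finset.sum_of_injOn (fun x => blockPerm x.1 x.2) ?_ (fun _ _ => by simp) ?_
      (fun _ _ => rfl)
    · intro x _ y _ hxy
      have := finSumFinEquiv.permCongr.injective hxy
      exact Equiv.Perm.sumCongrHom_injective (a₁ := x) (a₂ := y) this
    · intro σ _ hσ
      by_cases hm : ∀ i : Fin p, ∃ i' : Fin p, σ (Fin.castAdd q i) = Fin.castAdd q i'
      · exfalso
        apply hσ
        have hr : finSumFinEquiv.permCongr.symm σ ∈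
            (Equiv.Perm.sumCongrHom (Fin p) (Fin q)).range := by
          apply Equiv.Perm.mem_sumCongrHom_range_of_perm_mapsTo_inl
          rintro _ ⟨i, rfl⟩
          obtain ⟨i', hi'⟩ := hm i
          exact ⟨i', by simp [Equiv.permCongr_symm, Equiv.permCongr_apply, hi']⟩
        obtain ⟨x, hx⟩ := hr
        refine ⟨x, by simp, ?_⟩
        have hx' : Equiv.Perm.sumCongr x.1 x.2 = finSumFinEquiv.permCongr.symm σ := hx
        simp only [blockPerm, hx', Equiv.apply_symm_apply]
      · push Not at hm
        obtain ⟨i, hi⟩ := hm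
        obtain ⟨j, hj⟩ : ∃ j, σ (Fin.castAdd q i) = Fin.natAdd p j := by
          generalize hy : σ (Fin.castAdd q i) = y at hi
          induction y using Fin.addCases with
          | left y => exact absurd rfl (hi y)
          | right y => exact ⟨y, rfl⟩
        rw [h j _ i (by simp [hj]), zero_mul, mul_zero]
  rw [← hsub]
  -- The two signs from `a` and `b` cancel the sign of the block permutation, so all `p! q!`
  -- surviving terms are equal.
  have hterm : ∀ x : Equiv.Perm (Fin p) × Equiv.Perm (Fin q),
      ((Equiv.Perm.sign (blockPerm x.1 x.2) : ℤ) : ℝ) *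
        (a ((Fin.append v w ∘ blockPerm x.1 x.2) ∘ Fin.castAdd q) *
        b ((Fin.append v w ∘ blockPerm x.1 x.2) ∘ Fin.natAdd p)) = a v * b w := by
    rintro ⟨σ, τ⟩
    have h1 : (Fin.append v w ∘ blockPerm σ τ) ∘ Fin.castAdd q = v ∘ σ := by funext i; simp
    have h2 : (Fin.append v w ∘ blockPerm σ τ) ∘ Fin.natAdd p = w ∘ τ := by funext i; simp
    rw [h1, h2, map_perm_cast, map_perm_cast, sign_blockPerm]
    push_cast
    linear_combination (a v * b w) * (sign_mul_self_cast σ) *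
      ((Equiv.Perm.sign τ : ℤ) : ℝ) * ((Equiv.Perm.sign τ : ℤ) : ℝ) +
      (a v * b w) * sign_mul_self_cast τ
  rw [Finset.sum_congr rfl fun x _ => hterm x]
  have := Nat.cast_ne_zero (R := ℝ).2 p.factorial_ne_zero
  have := Nat.cast_ne_zero (R := ℝ).2 q.factorial_ne_zero
  simp [Fintype.card_perm, Fintype.card_prod]
  field_simp

/-- A form of degree larger than the codimension of a space of vectors killed by it vanishes. -/
theorem eq_zero_of_kills [FiniteDimensional ℝ V] (a : V [⋀^Fin p]→L[ℝ] ℝ) (K : Submodule ℝ V)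
    (hK : ∀ x ∈ K, Kills a x)
    (hd : Module.finrank ℝ V < p + Module.finrank ℝ K) : a = 0 := by
  ext v
  have hq := K.finrank_quotient_add_finrank
  -- The quotient by `K` has dimension less than `p`, so some combination of the `v j` with `c i ≠
  -- 0` lies in `K`. Putting it in slot `i` gives `0`, but also `c i • a v` by multilinearity and
  -- alternation.
  have hli : ¬ LinearIndependent ℝ fun i => K.mkQ (v i) := fun h => by
    have := h.fintype_card_le_finrank
    simp at this
    omega
  rw [Fintype.not_linearIndependent_iff] at hli
  obtain ⟨c, hc, i, hi⟩ := hli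
  have hx : ∑ j, c j • v j ∈ K := by
    rw [← Submodule.Quotient.mk_eq_zero, ← Submodule.mkQ_apply, map_sum]
    simpa using hc
  have h1 : a (Function.update v i (∑ j, c j • v j)) = 0 := hK _ hx _ i (by simp)
  have h2 := a.toAlternatingMap.map_update_sum Finset.univ i (fun j => c j • v j) v
  have h3 : ∑ j, a.toAlternatingMap (Function.update v i (c j • v j)) = c i • a v := by
    rw [Finset.sum_eq_single i]
    · rw [AlternatingMap.map_update_smul, Function.update_eq_self]
      rfl
    · intro j _ hj
      rw [AlternatingMap.map_update_smul, AlternatingMap.map_update_self _ _ hj.symm, smul_zero]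
    · simp
  have h4 : c i • a v = 0 := (h2.trans h3).symm.trans h1
  simpa [hi] using h4

end WedgeAlgebra

/-! ### Powers of two-forms and their radicals. -/

section TwoForms

variable {V : Type*} [AddCommGroup V] [Module ℝ V] [TopologicalSpace V]
variable {p : ℕ}

theorem map_pair_swap (b : V [⋀^Fin 2]→L[ℝ] ℝ) (x y : V) : b ![x, y] = - b ![y, x] := by
  have h := b.toAlternatingMap.map_swap ![y, x] (i := 0) (j := 1) (by simp)
  have e : ![y, x] ∘ Equiv.swap (0 : Fin 2) 1 = ![x, y] := by
    funext i; fin_cases i <;> simp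
  rw [e] at h
  exact h

/-- `(a ∧ b) ∧ c = (a ∧ c) ∧ b` for two-forms `b`, `c`. -/
theorem wedge_right_comm (a : V [⋀^Fin p]→L[ℝ] ℝ) (b c : V [⋀^Fin 2]→L[ℝ] ℝ) :
    wedge (wedge a b) c = wedge (wedge a c) b := by
  ext v
  rw [wedge_wedge_apply, wedge_wedge_apply]
  congr 1
  set x0 : Fin (p + 2 + 2) := Fin.castAdd 2 (Fin.natAdd p 0) with hx0
  set x1 : Fin (p + 2 + 2) := Fin.castAdd 2 (Fin.natAdd p 1) with hx1
  set x2 : Fin (p + 2 + 2) := Fin.natAdd (p + 2) 0 with hx2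
  set x3 : Fin (p + 2 + 2) := Fin.natAdd (p + 2) 1 with hx3
  have d02 : x0 ≠ x2 := by simp [hx0, hx2, Fin.ext_iff]
  have d13 : x1 ≠ x3 := by simp [hx1, hx3, Fin.ext_iff]
  have d01 : x0 ≠ x1 := by simp [hx0, hx1, Fin.ext_iff]
  have d03 : x0 ≠ x3 := by simp [hx0, hx3, Fin.ext_iff]; omega
  have d12 : x1 ≠ x2 := by simp [hx1, hx2, Fin.ext_iff]
  have d23 : x2 ≠ x3 := by simp [hx2, hx3, Fin.ext_iff]
  -- `τ` exchanges the two slots of `b` with the two slots of `c`; it is even, being a product of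
  -- two transpositions.
  set τ : Equiv.Perm (Fin (p + 2 + 2)) := Equiv.swap x0 x2 * Equiv.swap x1 x3 with hτ
  have hs : Equiv.Perm.sign τ = 1 := by
    rw [hτ, Equiv.Perm.sign_mul, Equiv.Perm.sign_swap d02, Equiv.Perm.sign_swap d13]; rfl
  have h := altSum_comp_perm (fun w : Fin (p + 2 + 2) → V =>
    a (w ∘ Fin.castAdd 2 ∘ Fin.castAdd 2) *
        c (w ∘ Fin.castAdd 2 ∘ Fin.natAdd p) * b (w ∘ Fin.natAdd (p + 2))) τ v
  rw [hs] at h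
  simp only [Units.val_one, Int.cast_one, one_mul] at h
  rw [← h]
  congr 1
  funext w
  have e0 : τ x0 = x2 := by
    simp [hτ, Equiv.swap_apply_of_ne_of_ne d01 d03]
  have e1 : τ x1 = x3 := by
    simp [hτ, Equiv.swap_apply_of_ne_of_ne d03.symm d23.symm]
  have e2 : τ x2 = x0 := by
    simp [hτ, Equiv.swap_apply_of_ne_of_ne d12.symm d23]
  have e3 : τ x3 = x1 := by
    simp [hτ, Equiv.swap_apply_of_ne_of_ne d01.symm d12]
  have ha : (w ∘ τ) ∘ Fin.castAdd 2 ∘ Fin.castAdd 2 = w ∘ Fin.castAdd 2 ∘ Fin.castAdd 2 := by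
    funext i
    have k (x : Fin (p + 2 + 2)) (hx : p ≤ x.val) :
        Fin.castAdd 2 (Fin.castAdd 2 i) ≠ x := fun e => by
      have := i.isLt
      rw [← e] at hx
      simp at hx
      omega
    simp only [Function.comp_apply, hτ, Equiv.Perm.mul_apply]
    rw [Equiv.swap_apply_of_ne_of_ne (k x1 (by simp [hx1])) (k x3 (by simp [hx3]; omega)),
      Equiv.swap_apply_of_ne_of_ne (k x0 (by simp [hx0])) (k x2 (by simp [hx2]))]
  have hb : (w ∘ τ) ∘ Fin.castAdd 2 ∘ Fin.natAdd p = w ∘ Fin.natAdd (p + 2) := by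
    funext i
    fin_cases i
    · exact congrArg w e0
    · exact congrArg w e1
  have hc : (w ∘ τ) ∘ Fin.natAdd (p + 2) = w ∘ Fin.castAdd 2 ∘ Fin.natAdd p := by
    funext i
    fin_cases i
    · exact congrArg w e2
    · exact congrArg w e3
  rw [ha, hb, hc]
  ring

/-- A two-form satisfying the Plücker relation squares to zero. -/
theorem wedge_wedge_self_of_plucker (a : V [⋀^Fin p]→L[ℝ] ℝ) (b : V [⋀^Fin 2]→L[ℝ] ℝ)
    (hb : ∀ x y z t, b ![x, y] * b ![z, t] - b ![x, z] * b ![y, t] + b ![x, t] * b ![y, z] = 0) :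
    wedge (wedge a b) b = 0 := by
  ext v
  rw [wedge_wedge_apply]
  set x0 : Fin (p + 2 + 2) := Fin.castAdd 2 (Fin.natAdd p 0) with hx0
  set x1 : Fin (p + 2 + 2) := Fin.castAdd 2 (Fin.natAdd p 1) with hx1
  set x2 : Fin (p + 2 + 2) := Fin.natAdd (p + 2) 0 with hx2
  set x3 : Fin (p + 2 + 2) := Fin.natAdd (p + 2) 1 with hx3
  have d13 : x1 ≠ x3 := by simp [hx1, hx3, Fin.ext_iff]
  have d01 : x0 ≠ x1 := by simp [hx0, hx1, Fin.ext_iff]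
  have d02 : x0 ≠ x2 := by simp [hx0, hx2, Fin.ext_iff]
  have d03 : x0 ≠ x3 := by simp [hx0, hx3, Fin.ext_iff]; omega
  have d12 : x1 ≠ x2 := by simp [hx1, hx2, Fin.ext_iff]
  have d23 : x2 ≠ x3 := by simp [hx2, hx3, Fin.ext_iff]
  have k (i : Fin p) (x : Fin (p + 2 + 2)) (hx : p ≤ x.val) :
      Fin.castAdd 2 (Fin.castAdd 2 i) ≠ x := fun e => by
    have := i.isLt
    rw [← e] at hx
    simp at hx
    omega
  set A : (Fin (p + 2 + 2) → V) → ℝ := fun w => a (w ∘ Fin.castAdd 2 ∘ Fin.castAdd 2) with hA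
  have hAswap (w : Fin (p + 2 + 2) → V) (x : Fin (p + 2 + 2)) (hx : p ≤ x.val) :
      A (w ∘ Equiv.swap x1 x) = A w := by
    simp only [hA]
    congr 1
    funext i
    simp only [Function.comp_apply]
    rw [Equiv.swap_apply_of_ne_of_ne (k i x1 (by simp [hx1])) (k i x hx)]
  set F : (Fin (p + 2 + 2) → V) → ℝ := fun w => A w * b ![w x0, w x1] * b ![w x2, w x3] with hF
  have hFeq : (fun w : Fin (p + 2 + 2) → V => a (w ∘ Fin.castAdd 2 ∘ Fin.castAdd 2) *
      b (w ∘ Fin.castAdd 2 ∘ Fin.natAdd p) * b (w ∘ Fin.natAdd (p + 2))) = F := by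
    funext w
    simp only [hF, hA]
    congr 2
    · congr 1
      funext i; fin_cases i <;> rfl
    · funext i; fin_cases i <;> rfl
  rw [hFeq]
  have h2 := altSum_comp_perm F (Equiv.swap x1 x2) v
  have h3 := altSum_comp_perm F (Equiv.swap x1 x3) v
  rw [Equiv.Perm.sign_swap d12] at h2
  rw [Equiv.Perm.sign_swap d13] at h3
  -- The Plücker relation says that `F` minus its two transposed copies vanishes pointwise. Each
  -- transposition contributes a further sign `-1` after alternation, so the sum is also `3 * altSum
  -- F v`.
  have hsum : altSum (fun w => (F w + (-1) * F (w ∘ Equiv.swap x1 x2)) +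
      (-1) * F (w ∘ Equiv.swap x1 x3)) v = 0 := by
    have : (fun w => (F w + (-1) * F (w ∘ Equiv.swap x1 x2)) +
      (-1) * F (w ∘ Equiv.swap x1 x3)) = fun _ => 0 := by
      funext w
      simp only [hF, hAswap w x2 (by simp [hx2]), hAswap w x3 (by simp [hx3]; omega),
        Function.comp_apply, Equiv.swap_apply_left, Equiv.swap_apply_right,
        Equiv.swap_apply_of_ne_of_ne d01 d02, Equiv.swap_apply_of_ne_of_ne d01 d03,
        Equiv.swap_apply_of_ne_of_ne d13.symm d23.symm, Equiv.swap_apply_of_ne_of_ne d12.symm d23]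
      have := hb (w x0) (w x1) (w x2) (w x3)
      rw [map_pair_swap b (w x2) (w x1)]
      linear_combination A w * this
    rw [this]
    simp [altSum]
  rw [altSum_add, altSum_add, altSum_const_mul, altSum_const_mul, h2, h3] at hsum
  have : altSum F v = 0 := by push_cast at hsum; linarith
  rw [this, mul_zero]
  rfl

/-- Inductive step of the truncated binomial formula below: the term with two factors `c` drops out.
-/
theorem wedge_add_of_plucker (a : V [⋀^Fin p]→L[ℝ] ℝ)
    (b c : V [⋀^Fin 2]→L[ℝ] ℝ)
    (hc : ∀ x y z t, c ![x, y] * c ![z, t] - c ![x, z] * c ![y, t] + c ![x, t] * c ![y, z] = 0)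
    (t : ℝ) :
    wedge (wedge a b + t • wedge a c) (b + c) =
      wedge (wedge a b) b + (t + 1) • wedge (wedge a b) c := by
  rw [wedge_add_right, wedge_add_left, wedge_add_left, wedge_smul_left, wedge_smul_left,
    wedge_right_comm a c b, wedge_wedge_self_of_plucker a c hc]
  module

/-- Two-forms commute and `c ∧ c` contributes nothing, so only the terms of degree at most one in
`c` survive in the binomial expansion. -/
theorem wedgePow_add_of_plucker (b c : V [⋀^Fin 2]→L[ℝ] ℝ)
    (hc : ∀ x y z t, c ![x, y] * c ![z, t] - c ![x, z] * c ![y, t] + c ![x, t] * c ![y, z] = 0)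
    (k : ℕ) :
    wedgePow (b + c) (k + 1) =
      wedgePow b (k + 1) + ((k : ℝ) + 1) • (wedge (wedgePow b k) c) := by
  induction k with
  | zero =>
    change wedge (wedgePow (b + c) 0) (b + c) = wedge (wedgePow b 0) b + _
    rw [wedge_add_right]
    simp
    rfl
  | succ k ih =>
    have h := wedge_add_of_plucker (wedgePow b k) b c hc ((k : ℝ) + 1)
    rw [Nat.cast_succ]
    refine Eq.trans ?_ h
    exact congrArg (fun X => wedge X (b + c)) ih

/-- The decomposable two-form `α ∧ β`. -/
def oneFormMul (α β : V →L[ℝ] ℝ) : V [⋀^Fin 2]→L[ℝ] ℝ where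
  toFun v := α (v 0) * β (v 1) - α (v 1) * β (v 0)
  map_update_add' := by
    intro inst v i x y
    rw [Subsingleton.elim inst (instDecidableEqFin 2)]
    fin_cases i <;> simp <;> ring
  map_update_smul' := by
    intro inst v i c x
    rw [Subsingleton.elim inst (instDecidableEqFin 2)]
    fin_cases i <;> simp <;> ring
  map_eq_zero_of_eq' := by
    intro v i j h hij
    have h01 : v 0 = v 1 := by
      fin_cases i <;> fin_cases j <;> simp_all
    simp [h01]
  cont := by
    change Continuous fun v : Fin 2 → V => α (v 0) * β (v 1) - α (v 1) * β (v 0)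
    fun_prop

@[simp] theorem oneFormMul_apply (α β : V →L[ℝ] ℝ) (v : Fin 2 → V) :
    oneFormMul α β v = α (v 0) * β (v 1) - α (v 1) * β (v 0) := rfl

theorem map_pair_self (b : V [⋀^Fin 2]→L[ℝ] ℝ) (x : V) : b ![x, x] = 0 := by
  have := map_pair_swap b x x
  linarith

/-- The one-form `b(x, ·)`. -/
def pairLeft (b : V [⋀^Fin 2]→L[ℝ] ℝ) (x : V) : V →L[ℝ] ℝ where
  toFun y := b ![x, y]
  map_add' y z := by
    have e (t : V) : Function.update ![x, 0] 1 t = ![x, t] := by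
      funext i; fin_cases i <;> simp
    have := b.map_update_add ![x, 0] 1 y z
    rwa [e, e, e] at this
  map_smul' c y := by
    have e (t : V) : Function.update ![x, 0] 1 t = ![x, t] := by
      funext i; fin_cases i <;> simp
    have := b.map_update_smul ![x, 0] 1 c y
    rwa [e, e] at this
  cont := b.cont.comp (by
    refine continuous_pi fun i => ?_
    fin_cases i
    · exact continuous_const
    · exact continuous_id)

@[simp] theorem pairLeft_apply (b : V [⋀^Fin 2]→L[ℝ] ℝ) (x y : V) : pairLeft b x y = b ![x, y] :=
  rfl

theorem kills_pair {b : V [⋀^Fin 2]→L[ℝ] ℝ} {x : V} (h : ∀ y, b ![x, y] = 0) : Kills b x := by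
  refine kills_of_vecCons fun v => ?_
  have : Matrix.vecCons x v = ![x, v 0] := by
    funext i; fin_cases i <;> rfl
  rw [this, h]

/-- The `n`-th power of a two-form whose radical has codimension at least `2n` is nonzero. -/
theorem wedgePow_ne_zero [IsTopologicalAddGroup V] [FiniteDimensional ℝ V] (n : ℕ)
    (b : V [⋀^Fin 2]→L[ℝ] ℝ) (K : Submodule ℝ V)
    (hK : ∀ x, (∀ y, b ![x, y] = 0) → x ∈ K)
    (hd : 2 * n + Module.finrank ℝ K ≤ Module.finrank ℝ V) : wedgePow b n ≠ 0 := by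
  induction n generalizing b K with
  | zero =>
    intro h
    have := DFunLike.congr_fun h Fin.elim0
    exact one_ne_zero this
  | succ n ih =>
    -- If `b` were zero, then `K` would be everything, leaving no room for codimension `2 (n + 1)`.
    obtain ⟨w, u₀, hu₀⟩ : ∃ w u, b ![w, u] ≠ 0 := by
      by_contra! h
      have : K = ⊤ := by
        rw [eq_top_iff]
        exact fun x _ => hK x (h x)
      rw [this, finrank_top] at hd
      omega
    obtain ⟨u, hu⟩ : ∃ u, b ![w, u] = 1 := by
      refine ⟨(b ![w, u₀])⁻¹ • u₀, ?_⟩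
      rw [← pairLeft_apply, map_smul, pairLeft_apply, smul_eq_mul, inv_mul_cancel₀ hu₀]
    -- `w, u` span a hyperbolic plane. The decomposable form `c` is chosen so that `b - c` has both
    -- vectors in its radical.
    set c : V [⋀^Fin 2]→L[ℝ] ℝ := oneFormMul (-pairLeft b u) (pairLeft b w) with hc
    have hcxy (x y : V) : c ![x, y] = b ![x, u] * b ![w, y] - b ![y, u] * b ![w, x] := by
      simp only [hc, oneFormMul_apply, neg_apply, pairLeft_apply,
        Matrix.cons_val_zero, Matrix.cons_val_one]
      rw [map_pair_swap b x u, map_pair_swap b y u]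
    set b' := b - c with hb'
    have hbb : b = b' + c := by rw [hb']; abel
    have hb'xy (x y : V) : b' ![x, y] = b ![x, y] - c ![x, y] := rfl
    have hw : Kills b' w := kills_pair fun y => by
      rw [hb'xy, hcxy, hu, map_pair_self]; ring
    have hu' : Kills b' u := kills_pair fun y => by
      rw [hb'xy, hcxy, hu, map_pair_self, map_pair_swap b y u]; ring
    -- Subtracting `c` enlarges the radical by at most `w` and `u`, so the codimension bound drops
    -- by at most `2`, as the induction requires.
    set K' : Submodule ℝ V := K ⊔ Submodule.span ℝ {w, u} with hK'
    have hK'mem (x : V) (hx : ∀ y, b' ![x, y] = 0) : x ∈ K' := by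
      have h1 : x - (b ![x, u] • w + b ![w, x] • u) ∈ K := by
        refine hK _ fun y => ?_
        have h2 := hx y
        rw [hb'xy, hcxy] at h2
        rw [map_pair_swap, ← pairLeft_apply, map_sub, map_add, map_smul, map_smul]
        simp only [pairLeft_apply, smul_eq_mul]
        rw [map_pair_swap b y x, map_pair_swap b y w]
        linarith
      have h2 : b ![x, u] • w + b ![w, x] • u ∈ Submodule.span ℝ {w, u} :=
        Submodule.mem_span_pair.2 ⟨_, _, rfl⟩
      have h3 := add_mem (Submodule.mem_sup_left h1 : _ ∈ K') (Submodule.mem_sup_right h2)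
      simpa using h3
    have hfr : Module.finrank ℝ K' ≤ Module.finrank ℝ K + 2 := by
      have h1 := Submodule.finrank_add_le_finrank_add_finrank K (Submodule.span ℝ {w, u})
      have h2 : Module.finrank ℝ (Submodule.span ℝ {w, u}) ≤ 2 := by
        classical
        have := finrank_span_le_card (R := ℝ) ({w, u} : Set V)
        refine this.trans ?_
        simpa using Finset.card_le_two (a := w) (b := u)
      exact h1.trans (by omega)
    have hne := ih b' K' hK'mem (by omega)
    intro h0
    apply hne
    ext v
    -- On `(v, w, u)` the term `b'^(n+1)` vanishes and the other one is `(n + 1) * b'^n(v)`, since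
    -- `c(w, u) = 1`. Thus `b^(n+1) = 0` would force `b'^n = 0`.
    rw [hbb, wedgePow_add_of_plucker b' c ?_ n] at h0
    · have h1 := DFunLike.congr_fun h0 (Fin.append v ![w, u])
      have h2 : wedgePow b' (n + 1) (Fin.append v ![w, u]) = 0 :=
        (hw.wedgePow (n + 1)) _ (Fin.natAdd (2 * n) 0) (by simp)
      have h3 := wedge_append (wedgePow b' n) c v ![w, u] (fun j => by
        fin_cases j
        · exact hw.wedgePow n
        · exact hu'.wedgePow n)
      have h4 : wedgePow b' (n + 1) (Fin.append v ![w, u]) +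
        ((n : ℝ) + 1) * wedge (wedgePow b' n) c (Fin.append v ![w, u]) = 0 := h1
      rw [h2, h3, hcxy, hu, map_pair_self] at h4
      have h5 : ((n : ℝ) + 1) ≠ 0 := by positivity
      simpa [h5] using h4
    · intro x y z t
      simp only [hcxy]
      ring

end TwoForms

/-! ### The Leibniz rule on a normed space -/

section Leibniz

/-- The alternatization of `x ↦ c(x)`, where `c(x)` is itself an alternating sum. -/
theorem altSum_cons_altSum {V : Type*} {m : ℕ} (G : V → (Fin m → V) → ℝ) (v : Fin (m + 1) → V) :
    altSum (fun w => altSum (G (w 0)) (Fin.tail w)) v =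
      m.factorial * altSum (fun w => G (w 0) (Fin.tail w)) v := by
  -- The inner permutations are viewed as the `m!` permutations of `Fin (m + 1)` fixing `0`.
  have h := altSum_sum_sign (fun w : Fin (m + 1) → V => G (w 0) (Fin.tail w))
    (fun σ : Equiv.Perm (Fin m) => Equiv.Perm.decomposeFin.symm (0, σ)) v
  rw [Fintype.card_perm, Fintype.card_fin] at h
  rw [← h]
  congr 1
  funext w
  rw [altSum]
  refine Finset.sum_congr rfl fun σ _ => ?_
  rw [Equiv.Perm.decomposeFin.symm_sign]
  have h1 : (w ∘ Equiv.Perm.decomposeFin.symm (0, σ)) 0 = w 0 := by simp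
  have h2 : Fin.tail (w ∘ Equiv.Perm.decomposeFin.symm (0, σ)) = Fin.tail w ∘ σ := by
    funext i
    simp [Fin.tail]
  rw [h1, h2]
  simp

variable {E : Type*} [NormedAddCommGroup E] [NormedSpace ℝ E]
variable {p q : ℕ}

open ContinuousAlternatingMap in
-- The inverse of `i.cycleRange` brings the `i`-th vector to the front and keeps the order of the
-- others; its sign is `(-1)^i`.
theorem alternatizeUncurryFin_eq_sum_sign (A : E →L[ℝ] E [⋀^Fin p]→L[ℝ] ℝ) (v : Fin (p + 1) → E) :
    alternatizeUncurryFin A v = ∑ i : Fin (p + 1),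
      ((Equiv.Perm.sign i.cycleRange.symm : ℤ) : ℝ) *
        A ((v ∘ i.cycleRange.symm) 0) (Fin.tail (v ∘ i.cycleRange.symm)) := by
  rw [alternatizeUncurryFin_apply]
  refine Finset.sum_congr rfl fun i _ => ?_
  have h1 : Fin.tail (v ∘ i.cycleRange.symm) = i.removeNth v := by
    funext j
    simp [Fin.tail, Fin.removeNth]
  rw [h1, Equiv.Perm.sign_symm, Fin.sign_cycleRange]
  simp

open ContinuousAlternatingMap in
-- Alternate the left side in two ways: as an alternating form it gains `(p + 1)!`, as a sum over `p
-- + 1` signed cycles it gains only `p + 1`.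
theorem alternatizeUncurryFin_eq_altSum (A : E →L[ℝ] E [⋀^Fin p]→L[ℝ] ℝ) (v : Fin (p + 1) → E) :
    alternatizeUncurryFin A v =
      (p.factorial : ℝ)⁻¹ * altSum (fun w => A (w 0) (Fin.tail w)) v := by
  have h1 := altSum_coe (alternatizeUncurryFin A) v
  have h2 := altSum_sum_sign (fun w : Fin (p + 1) → E => A (w 0) (Fin.tail w))
    (fun i : Fin (p + 1) => i.cycleRange.symm) v
  have h3 : (alternatizeUncurryFin A : (Fin (p + 1) → E) → ℝ) = fun w => ∑ i : Fin (p + 1),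
      ((Equiv.Perm.sign i.cycleRange.symm : ℤ) : ℝ) *
        A ((w ∘ i.cycleRange.symm) 0) (Fin.tail (w ∘ i.cycleRange.symm)) :=
    funext (alternatizeUncurryFin_eq_sum_sign A)
  rw [h3, h2, Fintype.card_fin, ← h3] at h1
  have h4 : ((p + 1 : ℕ) : ℝ) ≠ 0 := Nat.cast_ne_zero.2 p.succ_ne_zero
  have h5 : (p.factorial : ℝ) ≠ 0 := Nat.cast_ne_zero.2 p.factorial_ne_zero
  rw [Nat.factorial_succ, Nat.cast_mul, mul_assoc] at h1
  rw [mul_left_cancel₀ h4 h1]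
  field_simp

open ContinuousAlternatingMap in
-- Both sides reduce to `1 / (p! q!)` times the same alternating sum. No sign appears because the
-- new slot already stands directly before those of `a`.
theorem alternatizeUncurryFin_wedge_left (A : E →L[ℝ] E [⋀^Fin p]→L[ℝ] ℝ)
    (b : E [⋀^Fin q]→L[ℝ] ℝ) (D : E →L[ℝ] E [⋀^Fin (p + q)]→L[ℝ] ℝ)
    (hD : ∀ x, D x = wedge (A x) b) (v : Fin (p + q + 1) → E) :
    alternatizeUncurryFin D v =
      wedge (alternatizeUncurryFin A) b (v ∘ Fin.cast (Nat.add_right_comm p 1 q)) := by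
  have e1 : alternatizeUncurryFin D v = (p.factorial * q.factorial : ℝ)⁻¹ *
      altSum (fun w => A (w 0) (Fin.tail w ∘ Fin.castAdd q) * b (Fin.tail w ∘ Fin.natAdd p)) v := by
    rw [alternatizeUncurryFin_eq_altSum]
    simp_rw [hD, wedge_apply, altSum_const_mul]
    rw [altSum_cons_altSum fun x w => A x (w ∘ Fin.castAdd q) * b (w ∘ Fin.natAdd p)]
    have := Nat.cast_ne_zero (R := ℝ).2 (p + q).factorial_ne_zero
    field_simp
  set F : (Fin (p + 1 + q) → E) → ℝ := fun w =>
    A ((w ∘ Fin.castAdd q) 0) (Fin.tail (w ∘ Fin.castAdd q)) * b (w ∘ Fin.natAdd (p + 1)) with hF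
  have e2 : ∀ u : Fin (p + 1 + q) → E, wedge (alternatizeUncurryFin A) b u =
      (p.factorial * q.factorial : ℝ)⁻¹ * altSum F u := by
    intro u
    rw [wedge_apply]
    have h := altSum_sum_sign F
      (fun i : Fin (p + 1) => blockPerm i.cycleRange.symm (1 : Equiv.Perm (Fin q))) u
    have h' : (fun w : Fin (p + 1 + q) → E =>
        alternatizeUncurryFin A (w ∘ Fin.castAdd q) * b (w ∘ Fin.natAdd (p + 1))) =
        fun w => ∑ i : Fin (p + 1), ((Equiv.Perm.sign
          (blockPerm i.cycleRange.symm (1 : Equiv.Perm (Fin q))) : ℤ) : ℝ) *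
          F (w ∘ blockPerm i.cycleRange.symm (1 : Equiv.Perm (Fin q))) := by
      funext w
      rw [alternatizeUncurryFin_eq_sum_sign, Finset.sum_mul]
      refine Finset.sum_congr rfl fun i _ => ?_
      rw [sign_blockPerm, Equiv.Perm.sign_one, mul_one, mul_assoc]
      have k1 : (w ∘ blockPerm i.cycleRange.symm (1 : Equiv.Perm (Fin q))) ∘ Fin.castAdd q =
          (w ∘ Fin.castAdd q) ∘ i.cycleRange.symm := by funext j; simp
      have k2 : (w ∘ blockPerm i.cycleRange.symm (1 : Equiv.Perm (Fin q))) ∘ Fin.natAdd (p + 1) =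
          w ∘ Fin.natAdd (p + 1) := by funext j; simp
      simp only [hF]
      rw [k1, k2]
    rw [h', h, Fintype.card_fin, Nat.factorial_succ]
    have := Nat.cast_ne_zero (R := ℝ).2 p.factorial_ne_zero
    have := Nat.cast_ne_zero (R := ℝ).2 q.factorial_ne_zero
    have : ((p + 1 : ℕ) : ℝ) ≠ 0 := Nat.cast_ne_zero.2 p.succ_ne_zero
    push_cast at this ⊢
    field_simp
  rw [e1, e2, ← altSum_cast]
  congr 2
  funext w
  simp only [hF]
  congr 2
  funext j
  simp only [Function.comp_apply, Fin.tail]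
  congr 1
  ext
  simp
  omega

open ContinuousAlternatingMap in
-- As for the left factor, except that the new slot has to pass the `p` slots of `a`; this is the
-- sign `(-1)^p`.
theorem alternatizeUncurryFin_wedge_right (a : E [⋀^Fin p]→L[ℝ] ℝ)
    (B : E →L[ℝ] E [⋀^Fin q]→L[ℝ] ℝ) (D : E →L[ℝ] E [⋀^Fin (p + q)]→L[ℝ] ℝ)
    (hD : ∀ x, D x = wedge a (B x)) (v : Fin (p + q + 1) → E) :
    alternatizeUncurryFin D v = (-1) ^ p * wedge a (alternatizeUncurryFin B) v := by
  have e1 : alternatizeUncurryFin D v = (p.factorial * q.factorial : ℝ)⁻¹ *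
      altSum (fun w => a (Fin.tail w ∘ Fin.castAdd q) * B (w 0) (Fin.tail w ∘ Fin.natAdd p)) v := by
    rw [alternatizeUncurryFin_eq_altSum]
    simp_rw [hD, wedge_apply, altSum_const_mul]
    rw [altSum_cons_altSum fun x w => a (w ∘ Fin.castAdd q) * B x (w ∘ Fin.natAdd p)]
    have := Nat.cast_ne_zero (R := ℝ).2 (p + q).factorial_ne_zero
    field_simp
  set F : (Fin (p + (q + 1)) → E) → ℝ := fun w =>
    a (w ∘ Fin.castAdd (q + 1)) *
      B ((w ∘ Fin.natAdd p) 0) (Fin.tail (w ∘ Fin.natAdd p)) with hF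
  have e2 : ∀ u : Fin (p + (q + 1)) → E, wedge a (alternatizeUncurryFin B) u =
      (p.factorial * q.factorial : ℝ)⁻¹ * altSum F u := by
    intro u
    rw [wedge_apply]
    have h := altSum_sum_sign F
      (fun i : Fin (q + 1) => blockPerm (1 : Equiv.Perm (Fin p)) i.cycleRange.symm) u
    have h' : (fun w : Fin (p + (q + 1)) → E =>
        a (w ∘ Fin.castAdd (q + 1)) * alternatizeUncurryFin B (w ∘ Fin.natAdd p)) =
        fun w => ∑ i : Fin (q + 1), ((Equiv.Perm.sign
          (blockPerm (1 : Equiv.Perm (Fin p)) i.cycleRange.symm) : ℤ) : ℝ) *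
          F (w ∘ blockPerm (1 : Equiv.Perm (Fin p)) i.cycleRange.symm) := by
      funext w
      rw [alternatizeUncurryFin_eq_sum_sign, Finset.mul_sum]
      refine Finset.sum_congr rfl fun i _ => ?_
      rw [sign_blockPerm, Equiv.Perm.sign_one, one_mul, mul_left_comm]
      have k1 : (w ∘ blockPerm (1 : Equiv.Perm (Fin p)) i.cycleRange.symm) ∘ Fin.natAdd p =
          (w ∘ Fin.natAdd p) ∘ i.cycleRange.symm := by funext j; simp
      have k2 : (w ∘ blockPerm (1 : Equiv.Perm (Fin p)) i.cycleRange.symm) ∘ Fin.castAdd (q + 1) =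
          w ∘ Fin.castAdd (q + 1) := by funext j; simp
      simp only [hF]
      rw [k1, k2]
    rw [h', h, Fintype.card_fin, Nat.factorial_succ]
    have := Nat.cast_ne_zero (R := ℝ).2 p.factorial_ne_zero
    have := Nat.cast_ne_zero (R := ℝ).2 q.factorial_ne_zero
    have : ((q + 1 : ℕ) : ℝ) ≠ 0 := Nat.cast_ne_zero.2 q.succ_ne_zero
    push_cast at this ⊢
    field_simp
  -- The cycle bringing position `p` to the front relates the two alternating sums.
  set i₀ : Fin (p + q + 1) := Fin.natAdd p (0 : Fin (q + 1)) with hi₀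
  have hi₀v : (i₀ : ℕ) = p := by simp [hi₀]
  have hG := altSum_comp_perm (m := p + q + 1)
    (fun w => a (Fin.tail w ∘ Fin.castAdd q) * B (w 0) (Fin.tail w ∘ Fin.natAdd p))
    i₀.cycleRange.symm v
  have hG' : (fun w : Fin (p + q + 1) → E => a (Fin.tail (w ∘ i₀.cycleRange.symm) ∘ Fin.castAdd q) *
      B ((w ∘ i₀.cycleRange.symm) 0) (Fin.tail (w ∘ i₀.cycleRange.symm) ∘ Fin.natAdd p)) = F := by
    funext w
    have k1 : Fin.tail (w ∘ i₀.cycleRange.symm) ∘ Fin.castAdd q = w ∘ Fin.castAdd (q + 1) := by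
      funext j
      simp only [Function.comp_apply, Fin.tail, Fin.cycleRange_symm_succ]
      congr 1
      rw [Fin.succAbove_of_castSucc_lt _ _ (by simp [Fin.lt_def, hi₀v])]
      ext
      simp
    have k2 : (w ∘ i₀.cycleRange.symm) 0 = (w ∘ Fin.natAdd p) (0 : Fin (q + 1)) := by
      simp only [Function.comp_apply, Fin.cycleRange_symm_zero, hi₀]
    have k3 : Fin.tail (w ∘ i₀.cycleRange.symm) ∘ Fin.natAdd p =
        Fin.tail (w ∘ Fin.natAdd p : Fin (q + 1) → E) := by
      funext j
      simp only [Function.comp_apply, Fin.tail, Fin.cycleRange_symm_succ]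
      congr 1
      rw [Fin.succAbove_of_le_castSucc _ _ (by simp [Fin.le_def, hi₀v])]
      ext
      simp
      omega
    simp only [hF]
    rw [k1, k2, k3]
  rw [hG', Equiv.Perm.sign_symm, Fin.sign_cycleRange, hi₀v] at hG
  have hG2 : altSum F v = (-1) ^ p * altSum (m := p + q + 1) (fun w =>
      a (Fin.tail w ∘ Fin.castAdd q) * B (w 0) (Fin.tail w ∘ Fin.natAdd p)) v := by
    simpa using hG
  rw [e1, e2, hG2, mul_left_comm, ← mul_assoc ((-1) ^ p), ← mul_pow]
  simp

/-- A crude bound, sufficient to make the wedge product a bounded bilinear map and hence smooth with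
a product rule. -/
theorem norm_wedge_apply_le (a : E [⋀^Fin p]→L[ℝ] ℝ) (b : E [⋀^Fin q]→L[ℝ] ℝ)
    (v : Fin (p + q) → E) :
    ‖wedge a b v‖ ≤ ((p.factorial * q.factorial : ℝ)⁻¹ * (p + q).factorial * ‖a‖ * ‖b‖) *
      ∏ i, ‖v i‖ := by
  rw [wedge_apply, norm_mul, Real.norm_of_nonneg (by positivity)]
  have h : ‖altSum (fun w => a (w ∘ Fin.castAdd q) * b (w ∘ Fin.natAdd p)) v‖ ≤
      ∑ _σ : Equiv.Perm (Fin (p + q)), ‖a‖ * ‖b‖ * ∏ i, ‖v i‖ := by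
    refine norm_sum_le_of_le _ fun σ _ => ?_
    have hs : ‖((Equiv.Perm.sign σ : ℤ) : ℝ)‖ = 1 := by
      rcases Int.units_eq_one_or (Equiv.Perm.sign σ) with h | h <;> simp [h]
    rw [norm_mul, hs, one_mul, norm_mul]
    have h1 := a.le_opNorm ((v ∘ σ) ∘ Fin.castAdd q)
    have h2 := b.le_opNorm ((v ∘ σ) ∘ Fin.natAdd p)
    refine (mul_le_mul h1 h2 (norm_nonneg _) (by positivity)).trans (le_of_eq ?_)
    rw [← Equiv.prod_comp σ fun i => ‖v i‖, Fin.prod_univ_add]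
    simp only [Function.comp_apply]
    ring
  refine (mul_le_mul_of_nonneg_left h (by positivity)).trans (le_of_eq ?_)
  simp only [Finset.sum_const, Finset.card_univ, Fintype.card_perm, Fintype.card_fin,
    nsmul_eq_mul]
  ring

variable (E p q) in
/-- The wedge product as a continuous bilinear map. -/
def wedgeL : (E [⋀^Fin p]→L[ℝ] ℝ) →L[ℝ] (E [⋀^Fin q]→L[ℝ] ℝ) →L[ℝ] (E [⋀^Fin (p + q)]→L[ℝ] ℝ) :=
  LinearMap.mkContinuous₂
    (LinearMap.mk₂ ℝ wedge wedge_add_left wedge_smul_left wedge_add_right wedge_smul_right)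
    ((p.factorial * q.factorial : ℝ)⁻¹ * (p + q).factorial)
    fun a b => ContinuousAlternatingMap.opNorm_le_bound _ (by positivity)
      (norm_wedge_apply_le a b)

@[simp] theorem wedgeL_apply (a : E [⋀^Fin p]→L[ℝ] ℝ) (b : E [⋀^Fin q]→L[ℝ] ℝ) :
    wedgeL E p q a b = wedge a b := rfl

theorem extDeriv_wedge_apply {a : E → E [⋀^Fin p]→L[ℝ] ℝ} {b : E → E [⋀^Fin q]→L[ℝ] ℝ} {y : E}
    (ha : DifferentiableAt ℝ a y) (hb : DifferentiableAt ℝ b y) (v : Fin (p + q + 1) → E) :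
    extDeriv (fun z => wedge (a z) (b z)) y v =
      wedge (extDeriv a y) (b y) (v ∘ Fin.cast (Nat.add_right_comm p 1 q)) +
        (-1) ^ p * wedge (a y) (extDeriv b y) v := by
  have h := (wedgeL E p q).hasFDerivAt_of_bilinear ha.hasFDerivAt hb.hasFDerivAt
  have h' : HasFDerivAt (fun z => wedge (a z) (b z)) _ y := h
  rw [extDeriv, h'.fderiv, ContinuousAlternatingMap.alternatizeUncurryFin_add,
    ContinuousAlternatingMap.add_apply, add_comm]
  congr 1
  · exact alternatizeUncurryFin_wedge_left _ _ _ (fun _ => rfl) v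
  · exact alternatizeUncurryFin_wedge_right _ _ _ (fun _ => rfl) v

theorem extDeriv_wedge_one {a : E → E [⋀^Fin p]→L[ℝ] ℝ} {b : E → E [⋀^Fin 1]→L[ℝ] ℝ} {y : E}
    (ha : DifferentiableAt ℝ a y) (hb : DifferentiableAt ℝ b y) :
    extDeriv (fun z => wedge (a z) (b z)) y =
      wedge (extDeriv a y) (b y) + (-1 : ℝ) ^ p • wedge (a y) (extDeriv b y) := by
  ext v
  exact extDeriv_wedge_apply ha hb v

theorem extDeriv_wedge_two {a : E → E [⋀^Fin p]→L[ℝ] ℝ} {b : E → E [⋀^Fin 2]→L[ℝ] ℝ} {y : E}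
    (ha : DifferentiableAt ℝ a y) (hb : DifferentiableAt ℝ b y) (hdb : extDeriv b y = 0) :
    extDeriv (fun z => wedge (a z) (b z)) y = wedge (extDeriv a y) (b y) := by
  ext v
  refine (extDeriv_wedge_apply ha hb v).trans ?_
  rw [hdb, wedge_zero_right]
  simp

/-- If `i_X σ = 0` near `y`, then `L_X σ = i_X dσ` at `y`. -/
theorem lieDerivE_eq_extDeriv {k : ℕ} {X : E → E} {σ : E → E [⋀^Fin k]→L[ℝ] ℝ} {y : E}
    (hX : DifferentiableAt ℝ X y) (hσ : DifferentiableAt ℝ σ y)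
    (h : ∀ᶠ z in nhds y, Kills (σ z) (X z)) (v : Fin k → E) :
    lieDerivE X σ y v = extDeriv σ y (Matrix.vecCons (X y) v) := by
  rw [lieDerivE, extDeriv, ContinuousAlternatingMap.alternatizeUncurryFin_apply,
    Fin.sum_univ_succ]
  congr 1
  · simp
  · refine Finset.sum_congr rfl fun i _ => ?_
    cases k with
    | zero => exact i.elim0
    | succ k =>
      have h1 : i.succ.removeNth (Matrix.vecCons (X y) v) =
          Matrix.vecCons (X y) (i.removeNth v) := by
        funext j
        refine Fin.cases ?_ (fun j => ?_) j
        · simp [Fin.removeNth]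
        · simp [Fin.removeNth]
      have h2 : Function.update v i (fderiv ℝ X y (v i)) =
          i.insertNth (fderiv ℝ X y (v i)) (i.removeNth v) := by
        rw [Fin.insertNth_removeNth]
      -- Differentiating `σ(X, …) = 0` in the direction `v i` turns the term of `dσ` containing
      -- `∂_{v i} σ` into the term of `L_X σ` containing `∂_{v i} X`.
      have h3 : HasFDerivAt (𝕜 := ℝ) (fun z => σ z (Matrix.vecCons (X z) (i.removeNth v))) 0 y := by
        refine (hasFDerivAt_const (0 : ℝ) y).congr_of_eventuallyEq ?_
        filter_upwards [h] with z hz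
        exact hz _ 0 (by simp)
      have h4 := hσ.hasFDerivAt.continuousAlternatingMap_apply
        (g := fun j z => Matrix.vecCons (X z) (i.removeNth v) j)
        (g' := Matrix.vecCons (fderiv ℝ X y) fun _ => 0) (fun j => by
          refine Fin.cases ?_ (fun j => ?_) j
          · exact hX.hasFDerivAt
          · exact hasFDerivAt_const _ _)
      have h5 := DFunLike.congr_fun (h4.unique h3) (v i)
      have h6 (x : E) : Function.update (Matrix.vecCons (X y) (i.removeNth v)) 0 x =
          Matrix.vecCons x (i.removeNth v) := by
        funext j
        refine Fin.cases ?_ (fun j => ?_) j <;> simp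
      simp [Fin.sum_univ_succ, h6] at h5
      rw [h1, h2, ContinuousAlternatingMap.map_insertNth]
      simp only [Matrix.cons_val_succ, Fin.val_succ, pow_succ]
      have h7 : fderiv ℝ σ y (v i) (Matrix.vecCons (X y) (i.removeNth v)) =
          -σ y (Matrix.vecCons (fderiv ℝ X y (v i)) (i.removeNth v)) := by linarith
      rw [h7]
      simp

end Leibniz

/-! ### Forms in charts -/

section Charts

variable {E : Type*} [NormedAddCommGroup E] [NormedSpace ℝ E]
  {M : Type*} [TopologicalSpace M] [ChartedSpace E M]

theorem FormField.congr_point {k : ℕ} (σ : FormField E M k) {z z' : M} (hz : z = z') :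
    (σ z : E [⋀^Fin k]→L[ℝ] ℝ) = (σ z' : E [⋀^Fin k]→L[ℝ] ℝ) := by
  subst hz
  rfl

theorem minSmoothness_two_le_infty : minSmoothness ℝ 2 ≤ (∞ : WithTop ℕ∞) := by
  rw [minSmoothness_of_isRCLikeNormedField]
  exact WithTop.coe_le_coe.2 le_top

theorem chartForm_wedge {p q : ℕ} (a : FormField E M p) (b : FormField E M q) (x₀ : M) :
    chartForm (fun x => wedge (a x) (b x) : FormField E M (p + q)) x₀ =
      fun y => wedge (chartForm a x₀ y) (chartForm b x₀ y) := by
  funext y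
  exact wedge_compContinuousLinearMap _ _ _

theorem IsSmoothForm.wedge {p q : ℕ} {a : FormField E M p} {b : FormField E M q}
    (ha : IsSmoothForm a) (hb : IsSmoothForm b) :
    IsSmoothForm (fun x => wedge (a x) (b x) : FormField E M (p + q)) := by
  intro x₀
  rw [chartForm_wedge]
  exact ((wedgeL E p q).isBoundedBilinearMap.contDiff.comp_contDiffOn
    ((ha x₀).prodMk (hb x₀)) :)

theorem IsSmoothForm.contDiffAt {k : ℕ} {σ : FormField E M k} (h : IsSmoothForm σ) (x₀ : M)
    {y : E} (hy : y ∈ (extChartAt 𝓘(ℝ, E) x₀).target) : ContDiffAt ℝ ∞ (chartForm σ x₀) y :=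
  (h x₀).contDiffAt ((isOpen_extChartAt_target x₀).mem_nhds hy)

variable (E) in
/-- The transition map from the chart at `x₀` to the chart at `x₁`. -/
def chartTrans (x₀ x₁ : M) : E → E := extChartAt 𝓘(ℝ, E) x₁ ∘ (extChartAt 𝓘(ℝ, E) x₀).symm

variable (E) in
/-- The domain of `chartTrans E x₀ x₁`. -/
def transSource (x₀ x₁ : M) : Set E :=
  (extChartAt 𝓘(ℝ, E) x₀).target ∩
    (extChartAt 𝓘(ℝ, E) x₀).symm ⁻¹' (extChartAt 𝓘(ℝ, E) x₁).source

theorem isOpen_transSource (x₀ x₁ : M) : IsOpen (transSource E x₀ x₁) :=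
  (continuousOn_extChartAt_symm x₀).isOpen_inter_preimage (isOpen_extChartAt_target x₀)
    (isOpen_extChartAt_source x₁)

theorem chartTrans_mem {x₀ x₁ : M} {y : E} (hy : y ∈ transSource E x₀ x₁) :
    chartTrans E x₀ x₁ y ∈ (extChartAt 𝓘(ℝ, E) x₁).target :=
  (extChartAt 𝓘(ℝ, E) x₁).map_source hy.2

theorem extChartAt_symm_chartTrans {x₀ x₁ : M} {y : E} (hy : y ∈ transSource E x₀ x₁) :
    (extChartAt 𝓘(ℝ, E) x₁).symm (chartTrans E x₀ x₁ y) = (extChartAt 𝓘(ℝ, E) x₀).symm y :=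
  (extChartAt 𝓘(ℝ, E) x₁).left_inv hy.2

theorem mem_transSource_self (x₀ : M) {y : E} (hy : y ∈ (extChartAt 𝓘(ℝ, E) x₀).target) :
    y ∈ transSource E x₀ ((extChartAt 𝓘(ℝ, E) x₀).symm y) :=
  ⟨hy, mem_extChartAt_source _⟩

variable [IsManifold 𝓘(ℝ, E) ∞ M]

theorem mdifferentiableAt_extChartAt_symm {x₀ : M} {y : E}
    (hy : y ∈ (extChartAt 𝓘(ℝ, E) x₀).target) :
    MDifferentiableAt 𝓘(ℝ, E) 𝓘(ℝ, E) (extChartAt 𝓘(ℝ, E) x₀).symm y := by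
  have := mdifferentiableWithinAt_extChartAt_symm hy
  rwa [ModelWithCorners.range_eq_univ, mdifferentiableWithinAt_univ] at this

theorem contDiffAt_chartTrans {x₀ x₁ : M} {y : E} (hy : y ∈ transSource E x₀ x₁) :
    ContDiffAt ℝ ∞ (chartTrans E x₀ x₁) y := by
  have := contDiffWithinAt_ext_coord_change (I := 𝓘(ℝ, E)) (n := ∞) x₁ x₀ (y := y) (by
    rw [PartialEquiv.trans_source]; exact hy)
  rwa [ModelWithCorners.range_eq_univ, contDiffWithinAt_univ] at this

theorem mfderiv_extChartAt_symm_eq {x₀ x₁ : M} {y : E} (hy : y ∈ transSource E x₀ x₁) :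
    (mfderiv 𝓘(ℝ, E) 𝓘(ℝ, E) (extChartAt 𝓘(ℝ, E) x₀).symm y : E →L[ℝ] E) =
      (mfderiv 𝓘(ℝ, E) 𝓘(ℝ, E) (extChartAt 𝓘(ℝ, E) x₁).symm (chartTrans E x₀ x₁ y) :
        E →L[ℝ] E).comp (fderiv ℝ (chartTrans E x₀ x₁) y) := by
  have h1 : (extChartAt 𝓘(ℝ, E) x₀).symm =ᶠ[nhds y]
      (extChartAt 𝓘(ℝ, E) x₁).symm ∘ chartTrans E x₀ x₁ := by
    filter_upwards [(isOpen_transSource x₀ x₁).mem_nhds hy] with z hz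
    exact (extChartAt_symm_chartTrans hz).symm
  have h2 := mfderiv_comp (I := 𝓘(ℝ, E)) (I' := 𝓘(ℝ, E)) (I'' := 𝓘(ℝ, E)) y
    (mdifferentiableAt_extChartAt_symm (chartTrans_mem hy))
    ((contDiffAt_chartTrans hy).differentiableAt (by simp)).mdifferentiableAt
  rw [mfderiv_eq_fderiv] at h2
  exact (h1.mfderiv_eq (I := 𝓘(ℝ, E)) (I' := 𝓘(ℝ, E))).trans h2

theorem chartForm_chartTrans {k : ℕ} (σ : FormField E M k) {x₀ x₁ : M} {y : E}
    (hy : y ∈ transSource E x₀ x₁) :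
    chartForm σ x₀ y = (chartForm σ x₁ (chartTrans E x₀ x₁ y)).compContinuousLinearMap
      (fderiv ℝ (chartTrans E x₀ x₁) y) := by
  have h := mfderiv_extChartAt_symm_eq hy
  refine (congrArg (fun a : E [⋀^Fin k]→L[ℝ] ℝ => a.compContinuousLinearMap
    (mfderiv 𝓘(ℝ, E) 𝓘(ℝ, E) (extChartAt 𝓘(ℝ, E) x₀).symm y : E →L[ℝ] E))
    (FormField.congr_point σ (extChartAt_symm_chartTrans hy).symm)).trans ?_
  erw [h]
  rfl

/-- The exterior derivative may be computed in any chart. -/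
theorem chartForm_extDer {k : ℕ} {σ : FormField E M k} (hσ : IsSmoothForm σ) (x₀ : M) {y : E}
    (hy : y ∈ (extChartAt 𝓘(ℝ, E) x₀).target) :
    chartForm (extDer σ) x₀ y = extDeriv (chartForm σ x₀) y := by
  -- `extDer` at the point with coordinate `y` is computed in that point's own chart. The two charts
  -- are compared by naturality of `extDeriv` under the transition map.
  set x₁ := (extChartAt 𝓘(ℝ, E) x₀).symm y with hx₁
  have hy' := mem_transSource_self x₀ hy
  rw [← hx₁] at hy'
  have h1 : chartForm σ x₀ =ᶠ[nhds y] fun z =>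
      (chartForm σ x₁ (chartTrans E x₀ x₁ z)).compContinuousLinearMap
        (fderiv ℝ (chartTrans E x₀ x₁) z) := by
    filter_upwards [(isOpen_transSource x₀ x₁).mem_nhds hy'] with z hz
    exact chartForm_chartTrans σ hz
  rw [h1.extDeriv_eq, extDeriv_pullback
    ((hσ.contDiffAt x₁ (chartTrans_mem hy')).differentiableAt (by simp))
    (contDiffAt_chartTrans hy') minSmoothness_two_le_infty]
  have h2 := mfderiv_comp (I := 𝓘(ℝ, E)) (I' := 𝓘(ℝ, E)) (I'' := 𝓘(ℝ, E)) y
    (mdifferentiableAt_extChartAt (I := 𝓘(ℝ, E)) (mem_chart_source E x₁))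
    (mdifferentiableAt_extChartAt_symm hy)
  have h3 : (mfderiv 𝓘(ℝ, E) 𝓘(ℝ, E) (extChartAt 𝓘(ℝ, E) x₁) x₁ : E →L[ℝ] E).comp
      (mfderiv 𝓘(ℝ, E) 𝓘(ℝ, E) (extChartAt 𝓘(ℝ, E) x₀).symm y : E →L[ℝ] E) =
      fderiv ℝ (chartTrans E x₀ x₁) y := by
    rw [← mfderiv_eq_fderiv]
    exact h2.symm
  rw [← h3]
  rfl

theorem IsSmoothForm.extDer {k : ℕ} {σ : FormField E M k} (hσ : IsSmoothForm σ) :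
    IsSmoothForm (extDer σ) := by
  intro x₀
  have h : ContDiffOn ℝ ∞ (fun y => extDeriv (chartForm σ x₀) y)
      (extChartAt 𝓘(ℝ, E) x₀).target := by
    refine ContDiff.comp_contDiffOn
      (g := ContinuousAlternatingMap.alternatizeUncurryFinCLM ℝ E ℝ (n := k))
      (ContinuousLinearMap.contDiff _) ?_
    exact (hσ x₀).fderiv_of_isOpen (isOpen_extChartAt_target x₀) (by simp)
  exact h.congr fun y hy => chartForm_extDer hσ x₀ hy

/-- The chart used by `extDer` varies with the point, so `d² = 0` on `E` applies only once
`chartForm_extDer` is known on a neighbourhood. -/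
theorem extDer_extDer {k : ℕ} {σ : FormField E M k} (hσ : IsSmoothForm σ) :
    extDer (extDer σ) = 0 := by
  funext x
  have h1 : chartForm (extDer σ) x =ᶠ[nhds (extChartAt 𝓘(ℝ, E) x x)]
      extDeriv (chartForm σ x) := by
    filter_upwards [(isOpen_extChartAt_target x).mem_nhds (mem_extChartAt_target x)] with y hy
    exact chartForm_extDer hσ x hy
  have h2 := extDeriv_extDeriv_apply (hσ.contDiffAt x (mem_extChartAt_target x))
    minSmoothness_two_le_infty
  change ContinuousAlternatingMap.compContinuousLinearMap (extDeriv (chartForm (extDer σ) x) _) _ = _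
  rw [h1.extDeriv_eq, h2]
  rfl

theorem mfderiv_extChartAt_symm_self (x : M) :
    (mfderiv 𝓘(ℝ, E) 𝓘(ℝ, E) (extChartAt 𝓘(ℝ, E) x).symm (extChartAt 𝓘(ℝ, E) x x) : E →L[ℝ] E) =
      ContinuousLinearMap.id ℝ E := by
  have := mfderivWithin_range_extChartAt_symm (I := 𝓘(ℝ, E)) (x := x)
  rwa [ModelWithCorners.range_eq_univ, mfderivWithin_univ] at this

theorem chartForm_self {k : ℕ} (σ : FormField E M k) (x : M) :
    chartForm σ x (extChartAt 𝓘(ℝ, E) x x) = (σ x : E [⋀^Fin k]→L[ℝ] ℝ) := by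
  have h := mfderiv_extChartAt_symm_self (E := E) x
  have h2 := FormField.congr_point σ (extChartAt_to_inv (I := 𝓘(ℝ, E)) x)
  rw [← h2]
  unfold chartForm
  erw [h]
  rfl

theorem extDer_eq_extDeriv {k : ℕ} (σ : FormField E M k) (x : M) :
    (extDer σ x : E [⋀^Fin (k + 1)]→L[ℝ] ℝ) =
      extDeriv (chartForm σ x) (extChartAt 𝓘(ℝ, E) x x) := by
  have h : (mfderiv 𝓘(ℝ, E) 𝓘(ℝ, E) (extChartAt 𝓘(ℝ, E) x) x : E →L[ℝ] E) =
    ContinuousLinearMap.id ℝ E := mfderiv_extChartAt_self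
  unfold extDer
  erw [h]
  rfl

theorem extDer_wedge_one {p : ℕ} {a : FormField E M p} {b : FormField E M 1}
    (ha : IsSmoothForm a) (hb : IsSmoothForm b) :
    extDer (fun x => wedge (a x) (b x) : FormField E M (p + 1)) = fun x =>
      wedge (extDer a x) (b x) + (-1 : ℝ) ^ p • wedge (a x) (extDer b x) := by
  funext x
  have h := extDeriv_wedge_one (ha.differentiableAt x) (hb.differentiableAt x)
  rw [chartForm_self, chartForm_self, ← extDer_eq_extDeriv, ← extDer_eq_extDeriv,
    ← chartForm_wedge a b] at h
  exact (extDer_eq_extDeriv _ x).trans h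

theorem extDer_wedge_two {p : ℕ} {a : FormField E M p} {b : FormField E M 2}
    (ha : IsSmoothForm a) (hb : IsSmoothForm b) (hdb : extDer b = 0) :
    extDer (fun x => wedge (a x) (b x) : FormField E M (p + 2)) = fun x =>
      wedge (extDer a x) (b x) := by
  funext x
  have h := extDeriv_wedge_two (ha.differentiableAt x) (hb.differentiableAt x) (by
    rw [← extDer_eq_extDeriv, hdb]; rfl)
  rw [chartForm_self, ← extDer_eq_extDeriv, ← chartForm_wedge a b] at h
  exact (extDer_eq_extDeriv _ x).trans h

theorem chartVField_differentiableAt [CompleteSpace E] {X : VField E M} (hX : IsSmoothVField X)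
    (x : M) : DifferentiableAt ℝ (chartVField X x) (extChartAt 𝓘(ℝ, E) x x) := by
  have h1 : ContMDiffAt 𝓘(ℝ, E) (𝓘(ℝ, E).prod 𝓘(ℝ, E)) 1
      (fun x => Bundle.TotalSpace.mk' E x (X x))
      ((extChartAt 𝓘(ℝ, E) x).symm (extChartAt 𝓘(ℝ, E) x x)) :=
    (hX _).of_le (by simp)
  have h2 : ContMDiffAt 𝓘(ℝ, E) 𝓘(ℝ, E) ∞ (extChartAt 𝓘(ℝ, E) x).symm
      (extChartAt 𝓘(ℝ, E) x x) :=
    (contMDiffOn_extChartAt_symm x).contMDiffAt (extChartAt_target_mem_nhds x)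
  have h3 : (mfderiv 𝓘(ℝ, E) 𝓘(ℝ, E) (extChartAt 𝓘(ℝ, E) x).symm
      (extChartAt 𝓘(ℝ, E) x x)).IsInvertible := by
    have := isInvertible_mfderivWithin_extChartAt_symm (I := 𝓘(ℝ, E)) (mem_extChartAt_target x)
    rwa [ModelWithCorners.range_eq_univ, mfderivWithin_univ] at this
  have h4 := ContMDiffAt.mpullback_vectorField_preimage h1 h2 h3 (WithTop.coe_le_coe.2 le_top)
  exact (contMDiffAt_vectorSpace_iff_contDiffAt.1 h4).differentiableAt one_ne_zero

theorem chartForm_kills {k : ℕ} {σ : FormField E M k} {X : VField E M}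
    (h : ∀ x, Kills (σ x) (X x)) (x₀ : M) {y : E} (hy : y ∈ (extChartAt 𝓘(ℝ, E) x₀).target) :
    Kills (chartForm σ x₀ y) (chartVField X x₀ y) := by
  intro v i hi
  have h3 : (mfderiv 𝓘(ℝ, E) 𝓘(ℝ, E) (extChartAt 𝓘(ℝ, E) x₀).symm y).IsInvertible := by
    have := isInvertible_mfderivWithin_extChartAt_symm (I := 𝓘(ℝ, E)) hy
    rwa [ModelWithCorners.range_eq_univ, mfderivWithin_univ] at this
  refine h _ _ i ?_
  simp only [hi]
  exact h3.self_apply_inverse _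

/-- Cartan's formula `L_X = i_X d + d i_X`, with both terms zero. -/
theorem lieDer_eq_zero [CompleteSpace E] {k : ℕ} {σ : FormField E M k} (hσ : IsSmoothForm σ)
    (hd : extDer σ = 0) {X : VField E M} (hX : IsSmoothVField X) (h : ∀ x, Kills (σ x) (X x))
    (x : M) (v : Fin k → TangentSpace 𝓘(ℝ, E) x) : lieDer X σ x v = 0 := by
  refine (lieDerivE_eq_extDeriv (chartVField_differentiableAt hX x) (hσ.differentiableAt x) ?_
    _).trans ?_
  · filter_upwards [(isOpen_extChartAt_target x).mem_nhds (mem_extChartAt_target x)] with y hy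
    exact chartForm_kills h x hy
  · rw [← extDer_eq_extDeriv, hd]
    rfl

end Charts

/-! ### Stokes' theorem for exact top forms on a compact manifold -/

section Stokes

open MeasureTheory

theorem real_sign_mul_self (x : ℝ) : Real.sign x * x = |x| := by
  rcases lt_trichotomy x 0 with h | h | h
  · rw [Real.sign_of_neg h, abs_of_neg h]; ring
  · simp [h]
  · rw [Real.sign_of_pos h, abs_of_pos h, one_mul]

/-! ### Top forms on a vector space, and Stokes' theorem there. -/

section NormedSpace

variable {E : Type*} [NormedAddCommGroup E] [NormedSpace ℝ E]

theorem compContinuousLinearMap_apply_basis {N : ℕ} (e : Module.Basis (Fin N) ℝ E)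
    (a : E [⋀^Fin N]→L[ℝ] ℝ) (L : E →L[ℝ] E) :
    a.compContinuousLinearMap L e = L.det * a e := by
  have h := a.toAlternatingMap.eq_smul_basis_det e
  have h2 (v : Fin N → E) : a v = a e * e.det v := DFunLike.congr_fun h v
  rw [ContinuousAlternatingMap.compContinuousLinearMap_apply, h2, mul_comm]
  congr 1
  have := e.det_comp L.toLinearMap e
  rw [e.det_self, mul_one] at this
  exact this

theorem eq_smul_of_basis {N : ℕ} (e : Module.Basis (Fin N) ℝ E) (a b : E [⋀^Fin N]→L[ℝ] ℝ)
    (hb : b e ≠ 0) : a = (a e / b e) • b := by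
  ext v
  have h (c : E [⋀^Fin N]→L[ℝ] ℝ) : c v = c e * e.det v :=
    DFunLike.congr_fun (c.toAlternatingMap.eq_smul_basis_det e) v
  rw [ContinuousAlternatingMap.smul_apply, h a, h b, smul_eq_mul]
  field_simp

theorem apply_basis_ne_zero {N : ℕ} (e : Module.Basis (Fin N) ℝ E) {a : E [⋀^Fin N]→L[ℝ] ℝ}
    (ha : a ≠ 0) : a e ≠ 0 := by
  intro h0
  apply ha
  ext v
  have h : a v = a e * e.det v := DFunLike.congr_fun (a.toAlternatingMap.eq_smul_basis_det e) v
  rw [h, h0, zero_mul]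
  rfl

variable [FiniteDimensional ℝ E] [MeasurableSpace E] [BorelSpace E] (lam : Measure E) [lam.IsAddHaarMeasure]

/-- The integral of a directional derivative of a compactly supported function vanishes. -/
theorem integral_fderiv_apply_eq_zero {g : E → ℝ} (hg : ContDiff ℝ 1 g) (hc : HasCompactSupport g)
    (v : E) : ∫ y, fderiv ℝ g y v ∂lam = 0 := by
  have hi : Integrable (fun y => fderiv ℝ g y v) lam := by
    refine Continuous.integrable_of_hasCompactSupport ?_ ?_
    · exact (hg.continuous_fderiv one_ne_zero).clm_apply continuous_const
    · exact hc.fderiv_apply ℝ v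
  -- Integration by parts against the constant function `1`.
  have h := integral_mul_fderiv_eq_neg_fderiv_mul_of_integrable (μ := lam) (𝕜 := ℝ)
    (f := fun _ : E => (1 : ℝ)) (g := g) (v := v) (by simp) (by simpa using hi)
    (by simpa using hg.continuous.integrable_of_hasCompactSupport hc)
    (fun x _ => differentiableAt_const _) (fun x _ => (hg.differentiable one_ne_zero) x)
  simpa using h

/-- Stokes' theorem for compactly supported forms on a vector space. -/
theorem integral_extDeriv_eq_zero {d : ℕ} {G : E → E [⋀^Fin d]→L[ℝ] ℝ} (hG : ContDiff ℝ 1 G)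
    (hc : HasCompactSupport G) (v : Fin (d + 1) → E) : ∫ y, extDeriv G y v ∂lam = 0 := by
  have h1 (y : E) : extDeriv G y v =
      ∑ i, (-1 : ℝ) ^ i.val * fderiv ℝ (G · (i.removeNth v)) y (v i) := by
    rw [extDeriv_apply ((hG.differentiable one_ne_zero) y) v]
    simp
  simp_rw [h1]
  have hsm (w : Fin d → E) : ContDiff ℝ 1 fun y => G y w :=
    (ContinuousAlternatingMap.apply ℝ E ℝ w).contDiff.comp hG
  have hcw (w : Fin d → E) : HasCompactSupport fun y => G y w :=
    hc.comp_left (g := fun a : E [⋀^Fin d]→L[ℝ] ℝ => a w) rfl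
  rw [integral_finsetSum]
  · refine Finset.sum_eq_zero fun i _ => ?_
    rw [integral_const_mul, integral_fderiv_apply_eq_zero lam (hsm _) (hcw _), mul_zero]
  · intro i _
    refine Integrable.const_mul (Continuous.integrable_of_hasCompactSupport ?_ ?_) _
    · exact ((hsm _).continuous_fderiv one_ne_zero).clm_apply continuous_const
    · exact (hcw _).fderiv_apply ℝ _

end NormedSpace

variable {E : Type*} [NormedAddCommGroup E] [NormedSpace ℝ E]
  {M : Type*} [TopologicalSpace M] [ChartedSpace E M]

/-- The product of a function and a form. -/
def mulForm {k : ℕ} (r : M → ℝ) (σ : FormField E M k) : FormField E M k := fun x => r x • σ x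

theorem chartForm_mulForm {k : ℕ} (r : M → ℝ) (σ : FormField E M k) (x₀ : M) :
    chartForm (mulForm r σ) x₀ =
      fun y => r ((extChartAt 𝓘(ℝ, E) x₀).symm y) • chartForm σ x₀ y := rfl

/-- The chart expression of a top form evaluated on a fixed basis. -/
def chartDensity {N : ℕ} (e : Fin N → E) (σ : FormField E M N) (x₀ : M) (y : E) : ℝ :=
  chartForm σ x₀ y e

theorem IsSmoothForm.continuousOn_chartDensity {N : ℕ} {σ : FormField E M N} (hσ : IsSmoothForm σ)
    (e : Fin N → E) (x₀ : M) :
    ContinuousOn (chartDensity e σ x₀) (extChartAt 𝓘(ℝ, E) x₀).target :=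
  (ContinuousAlternatingMap.apply ℝ E ℝ e).continuous.comp_continuousOn (hσ x₀).continuousOn

/-- The integral of `h |σ|` over the chart at `x₀`. -/
def chartIntegral [MeasurableSpace E] (lam : Measure E) {N : ℕ} (e : Fin N → E)
    (σ : FormField E M N) (x₀ : M) (h : M → ℝ) : ℝ :=
  ∫ y in (extChartAt 𝓘(ℝ, E) x₀).target,
    h ((extChartAt 𝓘(ℝ, E) x₀).symm y) * |chartDensity e σ x₀ y| ∂lam

/-- The density need not be integrable over the whole chart, but the integrand vanishes off the
compact image of the support of `h`. -/
theorem integrableOn_chart [MeasurableSpace E] [BorelSpace E] [FiniteDimensional ℝ E]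
    (lam : Measure E) [lam.IsAddHaarMeasure]
    [CompactSpace M] {N : ℕ} (e : Fin N → E) {σ : FormField E M N} (hσ : IsSmoothForm σ) (x₀ : M)
    {h : M → ℝ} (hc : Continuous h) (hs : tsupport h ⊆ (extChartAt 𝓘(ℝ, E) x₀).source) :
    IntegrableOn (fun y => h ((extChartAt 𝓘(ℝ, E) x₀).symm y) * |chartDensity e σ x₀ y|)
      (extChartAt 𝓘(ℝ, E) x₀).target lam := by
  set K := extChartAt 𝓘(ℝ, E) x₀ '' tsupport h with hK
  have hKc : IsCompact K := (isClosed_tsupport h).isCompact.image_of_continuousOn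
    ((continuousOn_extChartAt x₀).mono hs)
  have hKt : K ⊆ (extChartAt 𝓘(ℝ, E) x₀).target := by
    rintro _ ⟨x, hx, rfl⟩
    exact (extChartAt 𝓘(ℝ, E) x₀).map_source (hs hx)
  have hcont : ContinuousOn (fun y => h ((extChartAt 𝓘(ℝ, E) x₀).symm y) *
      |chartDensity e σ x₀ y|) (extChartAt 𝓘(ℝ, E) x₀).target :=
    (hc.comp_continuousOn (continuousOn_extChartAt_symm x₀)).mul
      (hσ.continuousOn_chartDensity e x₀).abs
  have hKint := (hcont.mono hKt).integrableOn_compact (μ := lam) hKc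
  refine hKint.of_forall_sdiff_eq_zero (isOpen_extChartAt_target x₀).measurableSet ?_
  rintro y ⟨hy, hyK⟩
  have : h ((extChartAt 𝓘(ℝ, E) x₀).symm y) = 0 := by
    by_contra hne
    exact hyK ⟨_, subset_tsupport h hne, (extChartAt 𝓘(ℝ, E) x₀).right_inv hy⟩
  simp only [this, zero_mul]

theorem chartIntegral_pos [MeasurableSpace E] [BorelSpace E] [FiniteDimensional ℝ E]
    (lam : Measure E) [lam.IsAddHaarMeasure]
    [CompactSpace M] {N : ℕ} (e : Fin N → E) {σ : FormField E M N} (hσ : IsSmoothForm σ) (x₀ : M)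
    (hne : ∀ y ∈ (extChartAt 𝓘(ℝ, E) x₀).target, chartDensity e σ x₀ y ≠ 0)
    {h : M → ℝ} (hc : Continuous h) (hs : tsupport h ⊆ (extChartAt 𝓘(ℝ, E) x₀).source)
    (h0 : ∀ x, 0 ≤ h x) {x : M} (hx : 0 < h x) :
    0 < chartIntegral lam e σ x₀ h := by
  rw [chartIntegral, setIntegral_pos_iff_support_of_nonneg_ae]
  · set U := (extChartAt 𝓘(ℝ, E) x₀).target ∩ (extChartAt 𝓘(ℝ, E) x₀).symm ⁻¹' {z | 0 < h z} with hU
    have hUo : IsOpen U := (continuousOn_extChartAt_symm x₀).isOpen_inter_preimage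
      (isOpen_extChartAt_target x₀) (isOpen_lt continuous_const hc)
    have hxs := hs (subset_tsupport h hx.ne')
    have hUn : U.Nonempty := ⟨extChartAt 𝓘(ℝ, E) x₀ x, (extChartAt 𝓘(ℝ, E) x₀).map_source hxs, by
      rw [Set.mem_preimage, (extChartAt 𝓘(ℝ, E) x₀).left_inv hxs]
      exact hx⟩
    refine (hUo.measure_pos lam hUn).trans_le (measure_mono ?_)
    rintro y ⟨hy, hy'⟩
    refine ⟨?_, hy⟩
    have := hne y hy
    have hy'' : 0 < h ((extChartAt 𝓘(ℝ, E) x₀).symm y) := hy'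
    exact mul_ne_zero hy''.ne' (abs_ne_zero.2 this)
  · exact Filter.Eventually.of_forall fun y => mul_nonneg (h0 _) (abs_nonneg _)
  · exact integrableOn_chart lam e hσ x₀ hc hs

theorem chartIntegral_nonneg [MeasurableSpace E] (lam : Measure E) {N : ℕ} (e : Fin N → E)
    (σ : FormField E M N) (x₀ : M) {h : M → ℝ} (h0 : ∀ x, 0 ≤ h x) :
    0 ≤ chartIntegral lam e σ x₀ h :=
  integral_nonneg fun _ => mul_nonneg (h0 _) (abs_nonneg _)

theorem chartIntegral_sum [MeasurableSpace E] [BorelSpace E] [FiniteDimensional ℝ E]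
    (lam : Measure E) [lam.IsAddHaarMeasure]
    [CompactSpace M] {N : ℕ} (e : Fin N → E) {σ : FormField E M N} (hσ : IsSmoothForm σ) (x₀ : M)
    {ι : Type*} [Fintype ι] {h : ι → M → ℝ} (hc : ∀ i, Continuous (h i))
    (hs : ∀ i, tsupport (h i) ⊆ (extChartAt 𝓘(ℝ, E) x₀).source) :
    chartIntegral lam e σ x₀ (fun x => ∑ i, h i x) = ∑ i, chartIntegral lam e σ x₀ (h i) := by
  unfold chartIntegral
  rw [← integral_finsetSum _ fun i _ => integrableOn_chart lam e hσ x₀ (hc i) (hs i)]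
  simp_rw [Finset.sum_mul]

theorem image_chartTrans (x₀ x₁ : M) :
    chartTrans E x₀ x₁ '' transSource E x₀ x₁ = transSource E x₁ x₀ := by
  apply Set.Subset.antisymm
  · rintro _ ⟨y, hy, rfl⟩
    refine ⟨chartTrans_mem hy, ?_⟩
    rw [Set.mem_preimage, extChartAt_symm_chartTrans hy]
    exact (extChartAt 𝓘(ℝ, E) x₀).map_target hy.1
  · intro y hy
    refine ⟨chartTrans E x₁ x₀ y, ⟨chartTrans_mem hy, ?_⟩, ?_⟩
    · rw [Set.mem_preimage, extChartAt_symm_chartTrans hy]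
      exact (extChartAt 𝓘(ℝ, E) x₁).map_target hy.1
    · rw [chartTrans, Function.comp_apply, extChartAt_symm_chartTrans hy]
      exact (extChartAt 𝓘(ℝ, E) x₁).right_inv hy.1

theorem injOn_chartTrans (x₀ x₁ : M) :
    Set.InjOn (chartTrans E x₀ x₁) (transSource E x₀ x₁) := by
  intro y hy z hz h
  have := congrArg (extChartAt 𝓘(ℝ, E) x₁).symm h
  rw [extChartAt_symm_chartTrans hy, extChartAt_symm_chartTrans hz] at this
  exact (extChartAt 𝓘(ℝ, E) x₀).symm.injOn hy.1 hz.1 this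

variable [IsManifold 𝓘(ℝ, E) ∞ M]

theorem IsSmoothForm.mulForm {k : ℕ} {σ : FormField E M k} (hσ : IsSmoothForm σ) {r : M → ℝ}
    (hr : ContMDiff 𝓘(ℝ, E) 𝓘(ℝ, ℝ) ∞ r) : IsSmoothForm (mulForm r σ) := by
  intro x₀
  rw [chartForm_mulForm]
  have h : ContDiffOn ℝ ∞ (fun y => r ((extChartAt 𝓘(ℝ, E) x₀).symm y))
      (extChartAt 𝓘(ℝ, E) x₀).target :=
    (hr.comp_contMDiffOn (contMDiffOn_extChartAt_symm x₀)).contDiffOn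
  exact h.smul (hσ x₀)

theorem chartDensity_chartTrans {N : ℕ} (e : Module.Basis (Fin N) ℝ E)
    (σ : FormField E M N) {x₀ x₁ : M} {y : E} (hy : y ∈ transSource E x₀ x₁) :
    chartDensity e σ x₀ y =
      (fderiv ℝ (chartTrans E x₀ x₁) y).det * chartDensity e σ x₁ (chartTrans E x₀ x₁ y) := by
  rw [chartDensity, chartForm_chartTrans σ hy, compContinuousLinearMap_apply_basis]
  rfl

/-- The integral of `h |σ|` does not depend on the chart containing the support of `h`. -/
theorem chartIntegral_congr_chart [MeasurableSpace E] [BorelSpace E] [FiniteDimensional ℝ E]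
    (lam : Measure E) [lam.IsAddHaarMeasure] {N : ℕ} (e : Module.Basis (Fin N) ℝ E)
    (σ : FormField E M N) (x₀ x₁ : M) {h : M → ℝ}
    (h₀ : tsupport h ⊆ (extChartAt 𝓘(ℝ, E) x₀).source)
    (h₁ : tsupport h ⊆ (extChartAt 𝓘(ℝ, E) x₁).source) :
    chartIntegral lam e σ x₀ h = chartIntegral lam e σ x₁ h := by
  have key (a b : M) (hb : tsupport h ⊆ (extChartAt 𝓘(ℝ, E) b).source) :
      chartIntegral lam e σ a h = ∫ y in transSource E a b,
        h ((extChartAt 𝓘(ℝ, E) a).symm y) * |chartDensity e σ a y| ∂lam := by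
    rw [chartIntegral]
    refine setIntegral_eq_of_subset_of_forall_sdiff_eq_zero
      (isOpen_extChartAt_target a).measurableSet Set.inter_subset_left ?_
    rintro y ⟨hy, hy'⟩
    have : h ((extChartAt 𝓘(ℝ, E) a).symm y) = 0 := by
      by_contra hne
      exact hy' ⟨hy, hb (subset_tsupport h hne)⟩
    rw [this, zero_mul]
  -- On the overlap, the absolute Jacobian in the change of variables is exactly the factor by which
  -- `|σ|` transforms.
  rw [key x₀ x₁ h₁, key x₁ x₀ h₀, ← image_chartTrans x₀ x₁,
    integral_image_eq_integral_abs_det_fderiv_smul lam (isOpen_transSource x₀ x₁).measurableSet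
      (fun y hy => ((contDiffAt_chartTrans hy).differentiableAt
        (by simp)).hasFDerivAt.hasFDerivWithinAt) (injOn_chartTrans x₀ x₁)]
  refine setIntegral_congr_fun (isOpen_transSource x₀ x₁).measurableSet fun y hy => ?_
  simp only [smul_eq_mul]
  rw [extChartAt_symm_chartTrans hy, chartDensity_chartTrans e σ hy, abs_mul]
  ring

theorem chartDensity_ne_zero {N : ℕ} (e : Module.Basis (Fin N) ℝ E) {σ : FormField E M N}
    (hσ : ∀ x, σ x ≠ 0) (x₀ : M) {y : E} (hy : y ∈ (extChartAt 𝓘(ℝ, E) x₀).target) :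
    chartDensity e σ x₀ y ≠ 0 := by
  refine apply_basis_ne_zero e fun h0 => hσ ((extChartAt 𝓘(ℝ, E) x₀).symm y) ?_
  have hi : (mfderiv 𝓘(ℝ, E) 𝓘(ℝ, E) (extChartAt 𝓘(ℝ, E) x₀).symm y).IsInvertible := by
    have := isInvertible_mfderivWithin_extChartAt_symm (I := 𝓘(ℝ, E)) hy
    rwa [ModelWithCorners.range_eq_univ, mfderivWithin_univ] at this
  ext v
  have h1 := DFunLike.congr_fun h0 fun i =>
    (mfderiv 𝓘(ℝ, E) 𝓘(ℝ, E) (extChartAt 𝓘(ℝ, E) x₀).symm y).inverse (v i)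
  rw [chartForm] at h1
  refine Eq.trans ?_ h1
  refine congrArg _ (funext fun i => ?_)
  exact (hi.self_apply_inverse _).symm

/-- If `d(r β) = h μ` with `r` supported in a chart, then the integral of `h |μ|` vanishes. -/
theorem chartIntegral_extDer_eq_zero [MeasurableSpace E] [BorelSpace E] [FiniteDimensional ℝ E]
    (lam : Measure E) [lam.IsAddHaarMeasure] [CompactSpace M] {d : ℕ}
    (e : Module.Basis (Fin (d + 1)) ℝ E) {σ : FormField E M (d + 1)} (hσ : IsSmoothForm σ)
    (hne : ∀ x, σ x ≠ 0) {γ : FormField E M d} (hγ : IsSmoothForm γ) (x₀ : M)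
    {K : Set M} (hK : IsClosed K) (hKs : K ⊆ (extChartAt 𝓘(ℝ, E) x₀).source)
    (hγK : ∀ x, x ∉ K → γ x = 0) {h : M → ℝ} (hh : ∀ x, extDer γ x = h x • σ x) :
    chartIntegral lam e σ x₀ h = 0 := by
  classical
  set φ := extChartAt 𝓘(ℝ, E) x₀ with hφ
  -- The sign turns `|σ|` into `σ`. It is locally constant on the chart because the density is
  -- continuous and nonzero, so `d` passes through it; `G` extends smoothly by zero since its
  -- support is compact in the chart.
  set G : E → E [⋀^Fin d]→L[ℝ] ℝ := fun y =>
    if y ∈ φ.target then Real.sign (chartDensity e σ x₀ y) • chartForm γ x₀ y else 0 with hG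
  have hto : IsOpen φ.target := isOpen_extChartAt_target x₀
  have hKc : IsCompact (φ '' K) :=
    hK.isCompact.image_of_continuousOn ((continuousOn_extChartAt x₀).mono hKs)
  have hGK : ∀ y, y ∉ φ '' K → G y = 0 := by
    intro y hy
    by_cases hyt : y ∈ φ.target
    · have : φ.symm y ∉ K := fun hk => hy ⟨_, hk, φ.right_inv hyt⟩
      have h0 : chartForm γ x₀ y = 0 := by
        rw [chartForm]
        have := hγK _ this
        rw [hφ] at this
        rw [this]
        rfl
      simp only [hG, if_pos hyt, h0, smul_zero]
    · simp only [hG, if_neg hyt]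
  have hGloc : ∀ y ∈ φ.target, G =ᶠ[nhds y]
      Real.sign (chartDensity e σ x₀ y) • chartForm γ x₀ := by
    intro y hy
    have hcont : ContinuousAt (chartDensity e σ x₀) y :=
      (hσ.continuousOn_chartDensity e x₀).continuousAt (hto.mem_nhds hy)
    have hs : ∀ᶠ z in nhds y, Real.sign (chartDensity e σ x₀ z) =
        Real.sign (chartDensity e σ x₀ y) := by
      rcases lt_or_gt_of_ne (chartDensity_ne_zero e hne x₀ hy) with hlt | hgt
      · filter_upwards [hcont.eventually_lt continuousAt_const hlt] with z hz
        rw [Real.sign_of_neg hz, Real.sign_of_neg hlt]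
      · filter_upwards [continuousAt_const.eventually_lt hcont hgt] with z hz
        rw [Real.sign_of_pos hz, Real.sign_of_pos hgt]
    filter_upwards [hs, hto.mem_nhds hy] with z hz hzt
    simp only [hG, if_pos hzt, hz, Pi.smul_apply]
  have hGzero : ∀ y, y ∉ φ.target → G =ᶠ[nhds y] 0 := by
    intro y hy
    have : y ∈ (φ '' K)ᶜ := by
      rintro ⟨x, hx, rfl⟩
      exact hy (φ.map_source (hKs hx))
    filter_upwards [hKc.isClosed.isOpen_compl.mem_nhds this] with z hz
    exact hGK z hz
  have hGs : ContDiff ℝ 1 G := by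
    rw [contDiff_iff_contDiffAt]
    intro y
    by_cases hy : y ∈ φ.target
    · have h1 : ContDiffAt ℝ 1 (chartForm γ x₀) y := (hγ.contDiffAt x₀ hy).of_le (by simp)
      have h2 : ContDiffAt ℝ 1 (Real.sign (chartDensity e σ x₀ y) • chartForm γ x₀) y :=
        ContDiffAt.const_smul (f := chartForm γ x₀) (Real.sign (chartDensity e σ x₀ y)) h1
      exact h2.congr_of_eventuallyEq (hGloc y hy)
    · exact contDiffAt_const.congr_of_eventuallyEq (hGzero y hy)
  have hGc : HasCompactSupport G := HasCompactSupport.intro hKc hGK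
  have hst := integral_extDeriv_eq_zero lam hGs hGc e
  rw [chartIntegral, ← hst, ← integral_indicator hto.measurableSet]
  congr 1
  funext y
  by_cases hy : y ∈ φ.target
  · rw [Set.indicator_of_mem hy, (hGloc y hy).extDeriv_eq, extDeriv_smul, ← chartForm_extDer hγ x₀ hy]
    have h1 : chartForm (extDer γ) x₀ y = h (φ.symm y) • chartForm σ x₀ y := by
      have := hh (φ.symm y)
      rw [chartForm, this]
      rfl
    rw [h1, ContinuousAlternatingMap.smul_apply, ContinuousAlternatingMap.smul_apply]
    simp only [smul_eq_mul]
    change _ = Real.sign (chartDensity e σ x₀ y) * (h (φ.symm y) * chartDensity e σ x₀ y)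
    rw [mul_left_comm, real_sign_mul_self]
  · rw [Set.indicator_of_notMem hy, (hGzero y hy).extDeriv_eq]
    have h0 : extDeriv (0 : E → E [⋀^Fin d]→L[ℝ] ℝ) y = 0 := by
      simpa using extDeriv_smul (x := y) (0 : ℝ) (0 : E → E [⋀^Fin d]→L[ℝ] ℝ)
    rw [h0]
    rfl

end Stokes

/-! ### Exact top forms on a compact manifold. -/

section ExactTopForms

open MeasureTheory

variable {E : Type*} [NormedAddCommGroup E] [NormedSpace ℝ E]
  {M : Type*} [TopologicalSpace M] [ChartedSpace E M]

theorem isSmoothForm_sum {k : ℕ} {ι : Type*} (s : Finset ι) {σ : ι → FormField E M k}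
    (hσ : ∀ i, IsSmoothForm (σ i)) : IsSmoothForm (∑ i ∈ s, σ i) := by
  classical
  induction s using Finset.induction_on with
  | empty => simpa using isSmoothForm_zero
  | insert i s hi ih =>
    rw [Finset.sum_insert hi]
    exact fun x₀ => (hσ i x₀).add (ih x₀)

theorem extDer_sum {k : ℕ} {ι : Type*} (s : Finset ι) {σ : ι → FormField E M k}
    (hσ : ∀ i, IsSmoothForm (σ i)) : extDer (∑ i ∈ s, σ i) = ∑ i ∈ s, extDer (σ i) := by
  classical
  induction s using Finset.induction_on with
  | empty => simpa using extDer_zero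
  | insert i s hi ih =>
    rw [Finset.sum_insert hi, Finset.sum_insert hi,
      extDer_add (hσ i) (isSmoothForm_sum s hσ), ih]

/-- The ratio of two top forms. -/
def formRatio {N : ℕ} (e : Fin N → E) (a b : FormField E M N) (x : M) : ℝ :=
  (a x : E [⋀^Fin N]→L[ℝ] ℝ) e / (b x : E [⋀^Fin N]→L[ℝ] ℝ) e

theorem eq_formRatio_smul {N : ℕ} (e : Module.Basis (Fin N) ℝ E) (a : FormField E M N)
    {b : FormField E M N} (hb : ∀ x, b x ≠ 0) (x : M) : a x = formRatio e a b x • b x :=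
  eq_smul_of_basis e (a x) (b x) (apply_basis_ne_zero e (hb x))

variable [IsManifold 𝓘(ℝ, E) ∞ M]

theorem extDer_eq_zero_of_eventually {k : ℕ} {σ : FormField E M k} {x : M}
    (h : ∀ᶠ z in nhds x, σ z = 0) : extDer σ x = 0 := by
  have h1 : chartForm σ x =ᶠ[nhds (extChartAt 𝓘(ℝ, E) x x)] 0 := by
    have hc := (continuousAt_extChartAt_symm (I := 𝓘(ℝ, E)) x)
    have h2 := hc.eventually (by rw [extChartAt_to_inv]; exact h)
    filter_upwards [h2] with y hy
    rw [chartForm, hy]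
    rfl
  have h0 : extDeriv (0 : E → E [⋀^Fin k]→L[ℝ] ℝ) (extChartAt 𝓘(ℝ, E) x x) = 0 := by
    simpa using extDeriv_smul (x := extChartAt 𝓘(ℝ, E) x x) (0 : ℝ)
      (0 : E → E [⋀^Fin k]→L[ℝ] ℝ)
  exact (extDer_eq_extDeriv σ x).trans (h1.extDeriv_eq.trans h0)

/-- A finite smooth partition of unity by functions supported in charts. -/
theorem exists_finite_partition [FiniteDimensional ℝ E] [T2Space M] [CompactSpace M] :
    ∃ (t : Finset M) (r : t → M → ℝ), (∀ i, ContMDiff 𝓘(ℝ, E) 𝓘(ℝ, ℝ) ∞ (r i)) ∧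
      (∀ i x, 0 ≤ r i x) ∧ (∀ x, ∑ i, r i x = 1) ∧
      ∀ i : t, tsupport (r i) ⊆ (extChartAt 𝓘(ℝ, E) (i : M)).source := by
  obtain ⟨t, ht⟩ := isCompact_univ.elim_finite_subcover
    (fun x : M => (extChartAt 𝓘(ℝ, E) x).source) (fun x => isOpen_extChartAt_source x)
    (fun x _ => Set.mem_iUnion.2 ⟨x, mem_extChartAt_source x⟩)
  obtain ⟨f, hf⟩ := SmoothPartitionOfUnity.exists_isSubordinate 𝓘(ℝ, E) (s := (Set.univ : Set M))
    isClosed_univ (fun i : t => (extChartAt 𝓘(ℝ, E) (i : M)).source)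
    (fun i => isOpen_extChartAt_source _) (fun x hx => by
      obtain ⟨i, hi, hx⟩ := Set.mem_iUnion₂.1 (ht hx)
      exact Set.mem_iUnion.2 ⟨⟨i, hi⟩, hx⟩)
  refine ⟨t, fun i => f i, fun i => (f i).contMDiff, fun i x => f.nonneg i x, fun x => ?_, hf⟩
  rw [← finsum_eq_sum_of_fintype]
  exact f.sum_eq_one (Set.mem_univ x)

/-- `formRatio` reads each fibre in the preferred chart of its own point, which may jump. In one
fixed chart it equals the quotient of the densities, the Jacobian factors having cancelled. -/
theorem continuous_formRatio {N : ℕ} (e : Module.Basis (Fin N) ℝ E) {a b : FormField E M N}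
    (ha : IsSmoothForm a) (hb : IsSmoothForm b) (hb0 : ∀ x, b x ≠ 0) :
    Continuous (formRatio e a b) := by
  rw [continuous_iff_continuousAt]
  intro x
  have hden : ∀ y ∈ (extChartAt 𝓘(ℝ, E) x).target, chartDensity e b x y ≠ 0 :=
    fun y hy => chartDensity_ne_zero e hb0 x hy
  have h1 : ContinuousOn (fun z => chartDensity e a x (extChartAt 𝓘(ℝ, E) x z) /
      chartDensity e b x (extChartAt 𝓘(ℝ, E) x z)) (extChartAt 𝓘(ℝ, E) x).source := by
    refine ContinuousOn.div ?_ ?_ fun z hz => hden _ ((extChartAt 𝓘(ℝ, E) x).map_source hz)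
    · exact (ha.continuousOn_chartDensity e x).comp (continuousOn_extChartAt x)
        fun z hz => (extChartAt 𝓘(ℝ, E) x).map_source hz
    · exact (hb.continuousOn_chartDensity e x).comp (continuousOn_extChartAt x)
        fun z hz => (extChartAt 𝓘(ℝ, E) x).map_source hz
  have h2 := h1.continuousAt ((isOpen_extChartAt_source (I := 𝓘(ℝ, E)) x).mem_nhds
    (mem_extChartAt_source x))
  refine h2.congr ?_
  filter_upwards [(isOpen_extChartAt_source (I := 𝓘(ℝ, E)) x).mem_nhds
    (mem_extChartAt_source x)] with z hz
  have h3 : a = mulForm (formRatio e a b) b := funext fun w => eq_formRatio_smul e a hb0 w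
  have h4 : chartDensity e a x (extChartAt 𝓘(ℝ, E) x z) =
      formRatio e a b z * chartDensity e b x (extChartAt 𝓘(ℝ, E) x z) := by
    conv_lhs => rw [h3, chartDensity, chartForm_mulForm]
    beta_reduce
    rw [(extChartAt 𝓘(ℝ, E) x).left_inv hz]
    rfl
  rw [h4, mul_div_cancel_right₀ _ (hden _ ((extChartAt 𝓘(ℝ, E) x).map_source hz))]

/-- An exact top form on a nonempty compact manifold vanishes somewhere. -/
theorem exists_extDer_eq_zero [FiniteDimensional ℝ E] [T2Space M] [CompactSpace M] [Nonempty M]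
    {d : ℕ} (hd : Module.finrank ℝ E = d + 1) {β : FormField E M d} (hβ : IsSmoothForm β) :
    ∃ x, extDer β x = 0 := by
  by_contra! hne
  borelize E
  set lam : Measure E := MeasureTheory.Measure.addHaar with hlam
  set e : Module.Basis (Fin (d + 1)) ℝ E := Module.finBasisOfFinrankEq ℝ E hd with he
  set μ := extDer β with hμ
  have hμs : IsSmoothForm μ := hβ.extDer
  obtain ⟨t, r, hr, hr0, hr1, hrs⟩ := exists_finite_partition (E := E) (M := M)
  -- Here `d(r i β) = h i μ`. The `h i` sum to `1` because the `r i β` sum to `β`, while each `h i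
  -- |μ|` has integral zero by Stokes.
  set h : t → M → ℝ := fun i => formRatio e (extDer (mulForm (r i) β)) μ with hh
  have hsm (i : t) : IsSmoothForm (mulForm (r i) β) := hβ.mulForm (hr i)
  have hhc (i : t) : Continuous (h i) := continuous_formRatio e (hsm i).extDer hμs hne
  have hhs (i : t) : tsupport (h i) ⊆ tsupport (r i) := by
    refine closure_minimal ?_ (isClosed_tsupport _)
    intro x hx
    by_contra hxr
    apply hx
    have : extDer (mulForm (r i) β) x = 0 := by
      apply extDer_eq_zero_of_eventually
      filter_upwards [(isClosed_tsupport (r i)).isOpen_compl.mem_nhds hxr] with z hz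
      rw [mulForm, image_eq_zero_of_notMem_tsupport hz, zero_smul]
    simp only [hh, formRatio, this]
    exact zero_div _
  have hsum : ∑ i, mulForm (r i) β = β := by
    funext x
    have h1 : (∑ i, mulForm (r i) β) x = ∑ i, r i x • β x := Finset.sum_apply _ _ _
    rw [h1, ← Finset.sum_smul, hr1, one_smul]
  have hh1 (x : M) : ∑ i, h i x = 1 := by
    have h1 := extDer_sum Finset.univ hsm
    rw [hsum] at h1
    have h2 : extDer β x = ∑ i, extDer (mulForm (r i) β) x := by
      rw [h1]; exact Finset.sum_apply _ _ _
    have h3 : ∀ i, extDer (mulForm (r i) β) x = h i x • μ x := fun i =>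
      eq_formRatio_smul e _ hne x
    simp_rw [h3, ← Finset.sum_smul] at h2
    have h4 : (μ x : E [⋀^Fin (d + 1)]→L[ℝ] ℝ) e =
      (∑ i, h i x) * (μ x : E [⋀^Fin (d + 1)]→L[ℝ] ℝ) e := DFunLike.congr_fun h2 _
    exact (mul_eq_right₀ (apply_basis_ne_zero e (hne x))).1 h4.symm
  have hrc (i : t) : Continuous (r i) := (hr i).continuous
  have hz (i : t) : chartIntegral lam e μ i (h i) = 0 :=
    chartIntegral_extDer_eq_zero lam e hμs hne (hsm i) i (isClosed_tsupport (r i)) (hrs i)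
      (fun x hx => by rw [mulForm, image_eq_zero_of_notMem_tsupport hx, zero_smul])
      (fun x => eq_formRatio_smul e _ hne x)
  have hpl (i j : t) : tsupport (fun x => r j x * h i x) ⊆ tsupport (r j) := tsupport_mul_subset_left
  have hpr (i j : t) : tsupport (fun x => r j x * h i x) ⊆ tsupport (h i) :=
    tsupport_mul_subset_right
  -- The integrals of `r j * h i * |μ|` are summed in both orders: over `j` first, in chart `i`,
  -- they give `0`; over `i` first, in chart `j`, they give the integral of `r j * |μ|`.
  have h1 (i : t) : ∑ j, chartIntegral lam e μ i (fun x => r j x * h i x) = 0 := by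
    rw [← chartIntegral_sum lam e hμs i (h := fun j x => r j x * h i x) (fun j => (hrc j).mul (hhc i))
      (fun j => (hpr i j).trans ((hhs i).trans (hrs i)))]
    simp_rw [← Finset.sum_mul, hr1, one_mul]
    exact hz i
  have h2 (j : t) : ∑ i, chartIntegral lam e μ j (fun x => r j x * h i x) =
      chartIntegral lam e μ j (r j) := by
    rw [← chartIntegral_sum lam e hμs j (h := fun i x => r j x * h i x) (fun i => (hrc j).mul (hhc i))
      (fun i => (hpl i j).trans (hrs j))]
    simp_rw [← Finset.mul_sum, hh1, mul_one]
  have h3 : ∑ j : t, chartIntegral lam e μ j (r j) = 0 := by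
    simp_rw [← h2]
    rw [Finset.sum_comm]
    refine Finset.sum_eq_zero fun i _ => ?_
    rw [← h1 i]
    refine Finset.sum_congr rfl fun j _ => ?_
    exact chartIntegral_congr_chart lam e μ j i ((hpl i j).trans (hrs j))
      ((hpr i j).trans ((hhs i).trans (hrs i)))
  obtain ⟨x⟩ := ‹Nonempty M›
  obtain ⟨j, hj⟩ : ∃ j, 0 < r j x := by
    by_contra! hcon
    have := Finset.sum_nonpos fun i (_ : i ∈ Finset.univ) => hcon i
    rw [hr1] at this
    linarith
  have h4 := (Finset.sum_eq_zero_iff_of_nonneg fun (j : t) _ =>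
    chartIntegral_nonneg lam e μ j (hr0 j)).1 h3 j (Finset.mem_univ j)
  exact (chartIntegral_pos lam e hμs j (fun y hy => chartDensity_ne_zero e hne j hy) (hrc j)
    (hrs j) (hr0 j) hj).ne' h4

end ExactTopForms

/-! ### Contraction in the first slot versus in every slot. -/

section BasicForms

variable {E : Type*} [NormedAddCommGroup E] [NormedSpace ℝ E]
  {M : Type*} [TopologicalSpace M] [ChartedSpace E M]

theorem contractsToZero_of_kills {k : ℕ} {σ : FormField E M k} {X : VField E M}
    (h : ∀ x, Kills (σ x) (X x)) : ContractsToZero X σ := by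
  cases k with
  | zero => trivial
  | succ k => exact fun x v => h x _ 0 rfl

theorem ContractsToZero.kills {k : ℕ} {σ : FormField E M k} {X : VField E M}
    (h : ContractsToZero X σ) (x : M) : Kills (σ x) (X x) := by
  cases k with
  | zero => exact fun v i => i.elim0
  | succ k => exact kills_of_vecCons (h x)

end BasicForms

/-! ### The fundamental form and the construction of the exact top form. -/

namespace MetricFStructure

variable {E : Type*} [NormedAddCommGroup E] [NormedSpace ℝ E]
  {M : Type*} [TopologicalSpace M] [ChartedSpace E M] [IsManifold 𝓘(ℝ, E) ∞ M]
  {s : ℕ} (S : MetricFStructure E M s)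

theorem fundForm_pair (x : M) (v w : TangentSpace 𝓘(ℝ, E) x) :
    S.fundForm x ![v, w] = S.g.inner x v (S.f x w) := rfl

theorem kills_fundForm (α : Fin s) (x : M) : Kills (S.fundForm x) (S.ξ α x) :=
  kills_pair fun y => by
    rw [fundForm_pair, S.g.symm, S.inner_ξ, S.η_f]

theorem kills_η {α β : Fin s} (h : α ≠ β) (x : M) : Kills (S.η α x) (S.ξ β x) := by
  refine kills_of_vecCons fun v => ?_
  have : Matrix.vecCons (S.ξ β x) v = ![S.ξ β x] := by
    funext i; fin_cases i; rfl
  rw [this, S.η_ξ, if_neg h]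

/-- Testing against `f v` gives `g(f v, f v) = 0`, hence `f v = 0`, and the formula for `f²`
expresses `v` through the `ξ_α`. -/
theorem mem_charDistribution_of_fundForm {x : M} {v : TangentSpace 𝓘(ℝ, E) x}
    (h : ∀ w, S.fundForm x ![v, w] = 0) : v ∈ S.charDistribution x := by
  have h1 : S.f x v = 0 := by
    by_contra hne
    have h2 := S.g.pos x _ hne
    have h3 := h (S.f x v)
    rw [map_pair_swap, fundForm_pair] at h3
    linarith
  have h2 := S.f_sq x v
  rw [h1, map_zero] at h2
  have h3 : v = ∑ α, S.η α x ![v] • S.ξ α x := by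
    rw [← sub_eq_zero, ← neg_eq_zero, neg_sub, sub_eq_neg_add]
    exact h2.symm
  rw [h3]
  exact Submodule.sum_mem _ fun α _ => Submodule.smul_mem _ _ (Submodule.subset_span ⟨α, rfl⟩)

theorem linearIndependent_ξ (x : M) : LinearIndependent ℝ fun α => S.ξ α x := by
  rw [Fintype.linearIndependent_iff]
  intro c hc α
  have h1 : S.g.inner x (∑ β, c β • S.ξ β x) (S.ξ α x) = c α := by
    rw [S.inner_ξ]
    have : S.η α x ![∑ β, c β • S.ξ β x] = ∑ β, c β * S.η α x ![S.ξ β x] := by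
      rw [← S.inner_ξ]
      simp only [map_sum, map_smul, sum_apply, smul_apply,
        S.inner_ξ, smul_eq_mul]
    rw [this]
    simp [S.η_ξ]
  rw [← h1, hc]
  simp

/-- The radical of `ω` lies in a space spanned by `s` vectors, so its codimension is at least `2n`.
-/
theorem wedgePow_fundForm_ne_zero [FiniteDimensional ℝ E] {n : ℕ}
    (hd : Module.finrank ℝ E = 2 * n + s) (x : M) : S.fundFormPow n x ≠ 0 := by
  have hfr : Module.finrank ℝ (S.charDistribution x) ≤ s := by
    have := finrank_range_le_card (R := ℝ) fun α => S.ξ α x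
    change Module.finrank ℝ (Submodule.span ℝ (Set.range fun α => S.ξ α x)) ≤ s
    simpa [Set.finrank] using this
  have key (b : E [⋀^Fin 2]→L[ℝ] ℝ) (K : Submodule ℝ E) (hK : ∀ v, (∀ w, b ![v, w] = 0) → v ∈ K)
      (hKs : Module.finrank ℝ K ≤ s) : wedgePow b n ≠ 0 :=
    wedgePow_ne_zero n b K hK (by omega)
  exact key (S.fundForm x) (S.charDistribution x)
    (fun v hv => S.mem_charDistribution_of_fundForm hv) hfr

theorem fundFormPow_succ (k : ℕ) :
    S.fundFormPow (k + 1) =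
      (fun x => wedge (S.fundFormPow k x) (S.fundForm x) : FormField E M (2 * k + 2)) := rfl

theorem kills_fundFormPow (k : ℕ) (α : Fin s) (x : M) : Kills (S.fundFormPow k x) (S.ξ α x) :=
  (S.kills_fundForm α x).wedgePow k

variable {S}

/-- Smoothness comes from `ω = dη_0`; the index `0` exists because `s > 0`. -/
theorem IsContact.isSmoothForm_fundForm (hS : S.IsContact) : IsSmoothForm S.fundForm := by
  rw [← hS.2 ⟨0, hS.1⟩]
  exact (S.smooth_η _).extDer

theorem IsContact.extDer_fundForm (hS : S.IsContact) : extDer S.fundForm = 0 := by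
  rw [← hS.2 ⟨0, hS.1⟩]
  exact extDer_extDer (S.smooth_η _)

theorem IsContact.fundFormPow_smooth_closed (hS : S.IsContact) (k : ℕ) :
    IsSmoothForm (S.fundFormPow k) ∧ extDer (S.fundFormPow k) = 0 := by
  induction k with
  | zero =>
    have h (x₀ : M) : chartForm (S.fundFormPow 0) x₀ =
        fun _ => ContinuousAlternatingMap.constOfIsEmpty ℝ E (Fin 0) (1 : ℝ) := rfl
    refine ⟨fun x₀ => by rw [h]; exact contDiffOn_const, ?_⟩
    funext x
    refine (extDer_eq_extDeriv _ x).trans ?_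
    rw [h]
    refine (extDeriv_constOfIsEmpty (fun _ : E => (1 : ℝ)) _).trans ?_
    ext v
    simp
    rfl
  | succ k ih =>
    rw [S.fundFormPow_succ]
    refine ⟨ih.1.wedge hS.isSmoothForm_fundForm, ?_⟩
    refine (extDer_wedge_two ih.1 hS.isSmoothForm_fundForm hS.extDer_fundForm).trans ?_
    funext x
    rw [ih.2]
    exact wedge_zero_left _

theorem IsContact.fundFormPow_mem (hS : S.IsContact) [CompleteSpace E] (k : ℕ) :
    S.fundFormPow k ∈ closedBasicForms S.charDistribution (2 * k) := by
  obtain ⟨h1, h2⟩ := hS.fundFormPow_smooth_closed k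
  refine ⟨⟨h1, fun X hX => ?_⟩, h2⟩
  have h3 (x : M) : Kills (S.fundFormPow k x) (X x) :=
    Kills.of_mem_span (s := Set.range fun α => S.ξ α x)
      (by rintro _ ⟨α, rfl⟩; exact S.kills_fundFormPow k α x) (hX.2 x)
  exact ⟨contractsToZero_of_kills h3, lieDer_eq_zero h1 h2 hX.1 h3⟩

/-- A primitive of `ω^(k+1)` yields one of every higher power. -/
theorem IsContact.exists_primitive_of_le (hS : S.IsContact) {k m : ℕ} (hkm : k ≤ m)
    (h : ∃ τ : FormField E M (2 * k + 1), IsSmoothForm τ ∧ (∀ α x, Kills (τ x) (S.ξ α x)) ∧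
      extDer τ = S.fundFormPow (k + 1)) :
    ∃ τ : FormField E M (2 * m + 1), IsSmoothForm τ ∧ (∀ α x, Kills (τ x) (S.ξ α x)) ∧
      extDer τ = S.fundFormPow (m + 1) := by
  induction m, hkm using Nat.le_induction with
  | base => exact h
  | succ m _ ih =>
    obtain ⟨τ, h1, h2, h3⟩ := ih
    refine ⟨(fun x => wedge (τ x) (S.fundForm x) : FormField E M (2 * m + 1 + 2)),
      h1.wedge hS.isSmoothForm_fundForm, fun α x => (h2 α x).wedge (S.kills_fundForm α x), ?_⟩
    refine (extDer_wedge_two h1 hS.isSmoothForm_fundForm hS.extDer_fundForm).trans ?_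
    rw [h3]
    rfl

/-- Wedging a primitive of `ω^(m+1)` with the first `j` of the `η_α`. -/
theorem IsContact.exists_primitive_wedge_η (hS : S.IsContact) [FiniteDimensional ℝ E] {m : ℕ}
    (hd : Module.finrank ℝ E = 2 * (m + 1) + s)
    (h : ∃ τ : FormField E M (2 * m + 1), IsSmoothForm τ ∧ (∀ α x, Kills (τ x) (S.ξ α x)) ∧
      extDer τ = S.fundFormPow (m + 1)) (j : ℕ) (hj : j ≤ s) :
    ∃ T : FormField E M (2 * m + 1 + j), IsSmoothForm T ∧
      (∀ α : Fin s, j ≤ α → ∀ x, Kills (T x) (S.ξ α x)) ∧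
      (∀ α : Fin s, j ≤ α → ∀ x, Kills (extDer T x) (S.ξ α x)) ∧ ∀ x, extDer T x ≠ 0 := by
  induction j with
  | zero =>
    obtain ⟨τ, h1, h2, h3⟩ := h
    refine ⟨τ, h1, fun α _ x => h2 α x, fun α _ x => ?_, fun x => ?_⟩
    · rw [h3]
      exact S.kills_fundFormPow (m + 1) α x
    · rw [h3]
      exact S.wedgePow_fundForm_ne_zero hd x
  | succ j ih =>
    obtain ⟨T, h1, h2, h3, h4⟩ := ih (by omega)
    set β : Fin s := ⟨j, hj⟩ with hβ
    -- `T ∧ ω` has degree `2m + 3 + j` and is annihilated by the `s - j` independent vectors `ξ_j,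
    -- …, ξ_{s-1}`, whose span has codimension only `2m + 2 + j`.
    have hz (x : M) : wedge (T x) (S.fundForm x) = 0 := by
      set ζ : Fin (s - j) → Fin s := fun i => ⟨j + i, by omega⟩ with hζ
      have hli : LinearIndependent ℝ fun i => S.ξ (ζ i) x :=
        (S.linearIndependent_ξ x).comp ζ fun a b hab => by
          simp only [hζ, Fin.mk.injEq] at hab
          ext; omega
      refine eq_zero_of_kills (V := E) _
        (Submodule.span ℝ (Set.range fun i => S.ξ (ζ i) x)) (fun v hv => ?_) ?_
      · refine Kills.of_mem_span ?_ hv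
        rintro _ ⟨i, rfl⟩
        exact (h2 (ζ i) (by simp [hζ]) x).wedge (S.kills_fundForm _ x)
      · have := finrank_span_eq_card hli
        rw [Fintype.card_fin] at this
        change _ < _ + Module.finrank ℝ (Submodule.span ℝ (Set.range fun i => S.ξ (ζ i) x))
        rw [this]
        omega
    have hT : extDer (fun x => wedge (T x) (S.η β x) : FormField E M (2 * m + 1 + j + 1)) =
        fun x => wedge (extDer T x) (S.η β x) := by
      rw [extDer_wedge_one h1 (S.smooth_η β), hS.2 β]
      funext x
      rw [hz x, smul_zero]
      exact add_zero _
    have hne (α : Fin s) (hα : j + 1 ≤ α) : β ≠ α := by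
      rintro rfl
      simp [hβ] at hα
    refine ⟨(fun x => wedge (T x) (S.η β x) : FormField E M (2 * m + 1 + j + 1)),
      h1.wedge (S.smooth_η β), fun α hα x => (h2 α (by omega) x).wedge (S.kills_η (hne α hα) x),
      fun α hα x => ?_, fun x => ?_⟩
    · rw [hT]
      exact (h3 α (by omega) x).wedge (S.kills_η (hne α hα) x)
    · rw [hT]
      intro h0
      apply h4 x
      ext v
      -- Since `ξ_β` annihilates `dT` and `η_β(ξ_β) = 1`, putting `ξ_β` in the last slot of `dT ∧
      -- η_β` recovers `dT`.
      have h5 := wedge_append (extDer T x) (S.η β x) v ![S.ξ β x] (fun i => by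
        fin_cases i
        exact h3 β le_rfl x)
      rw [S.η_ξ, if_pos rfl, mul_one] at h5
      rw [← h5]
      exact DFunLike.congr_fun h0 _

end MetricFStructure

end FKContact

end

/-! ### The nonvanishing of the basic classes. -/

theorem lemma6p3 {n s : ℕ} {M : Type*} [TopologicalSpace M] [T2Space M] [CompactSpace M]
    [Nonempty M] [ChartedSpace (EuclideanSpace ℝ (Fin (2 * n + s))) M]
    [IsManifold 𝓘(ℝ, EuclideanSpace ℝ (Fin (2 * n + s))) ∞ M]
    (S : FKContact.MetricFStructure (EuclideanSpace ℝ (Fin (2 * n + s))) M s)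
    (hS : S.IsKContact) (k : ℕ) (hk : k ≤ n) :
    ∃ h : S.fundFormPow k ∈ FKContact.closedBasicForms S.charDistribution (2 * k),
      FKContact.basicClass S.charDistribution (S.fundFormPow k) h ≠ 0 := by
  have hmem := hS.1.fundFormPow_mem k
  refine ⟨hmem, fun h0 => ?_⟩
  have hex : S.fundFormPow k ∈ FKContact.exactBasicForms S.charDistribution (2 * k) :=
    (Submodule.Quotient.mk_eq_zero ((FKContact.exactBasicForms S.charDistribution
      (2 * k)).submoduleOf (FKContact.closedBasicForms S.charDistribution (2 * k)))).1 h0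
  cases k with
  | zero =>
    obtain ⟨x⟩ := ‹Nonempty M›
    have h1 : S.fundFormPow 0 = 0 := hex
    exact one_ne_zero (DFunLike.congr_fun (congrFun h1 x) Fin.elim0 : (1 : ℝ) = 0)
  | succ k =>
    -- Writing `n = m + 1` makes the degree `2n - 1` of a primitive of `ω^n` equal to `2m + 1`,
    -- without subtraction.
    obtain ⟨m, rfl⟩ : ∃ m, n = m + 1 := ⟨n - 1, by omega⟩
    obtain ⟨τ, hτ, hdτ⟩ : ∃ τ ∈ FKContact.basicForms S.charDistribution (2 * k + 1),
      FKContact.extDer τ = S.fundFormPow (k + 1) := hex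
    have hd : Module.finrank ℝ (EuclideanSpace ℝ (Fin (2 * (m + 1) + s))) = 2 * (m + 1) + s := by
      simp
    have hτξ (α : Fin s) (x : M) : FKContact.Kills (τ x) (S.ξ α x) :=
      (hτ.2 (S.ξ α) ⟨S.smooth_ξ α, fun x => Submodule.subset_span ⟨α, rfl⟩⟩).1.kills x
    have hprim := hS.1.exists_primitive_of_le (by omega : k ≤ m) ⟨τ, hτ.1, hτξ, hdτ⟩
    -- With all `s` one-forms used, `T` has degree `2m + 1 + s`, one less than the dimension, so
    -- `dT` is a nowhere vanishing exact top form.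
    obtain ⟨T, hT, -, -, hT0⟩ := hS.1.exists_primitive_wedge_η hd hprim s le_rfl
    obtain ⟨x, hx⟩ := FKContact.exists_extDer_eq_zero (by rw [hd]; ring) hT
    exact hT0 x hx
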